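/- **Setting.** Let $\mathbb C^n_*$ be the set of $\boldsymbol t=(t_1,\dots,t_n)\in\mathbb C^n$ with pairwise different coordinates, let $\mathcal D\subseteq\mathbb C^n_*$ be a domain, and let $Q_1,\dots,Q_n$ be $k\times k$-matrix functions, holomorphic in $\mathcal D$, with $\sum_{j}Q_j(\boldsymbol t)=0$ for all $\boldsymbol t\in\mathcal D$. Consider the holomorphic family of Fuchsian systems $$\frac{dY}{dx}=\Big(\sum_{1\le j\le n}\frac{Q_j(\boldsymbol t)}{x-t_j}\Big)Y .\qquad(1)$$ For a space $X$ and $x_0\in X$, $\operatorname{cov}(X;x_0)$ denotes the universal covering space, i.e. the set of pairs $(x,\alpha)$, where $\alpha$ is a homotopy class of paths in $X$ from $x_0$ to $x$; $\beta\cdot\alpha$ denotes the path "first $\alpha$, then $\beta$". For $\boldsymbol t\in\mathcal D$ let $Y(\cdot,\boldsymbol t)$ be the solution of (1), holomorphic on $\operatorname{cov}(\mathbb{CP}^1\setminus\{t_1,\dots,t_n\};\infty)$, with $Y=I$ at $x=\infty$. For a loop $\gamma$ in $\mathbb{CP}^1\setminus\{t_1,\dots,t_n\}$ based at $\infty$,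 the monodromy matrix $M_\gamma(\boldsymbol t)$ is the constant matrix with $Y((x,\alpha\cdot\gamma),\boldsymbol t)=Y((x,\alpha),\boldsymbol t)\,M_\gamma(\boldsymbol t)$ for all $(x,\alpha)$. An *open cylindrical neighborhood* of $\boldsymbol t^0$ is a product $\mathcal W=\mathcal W_1\times\dots\times\mathcal W_n$ of simply connected open sets $\mathcal W_j\ni t^0_j$ in $\mathbb C$ such that each $\mathbb C\setminus\overline{\mathcal W_j}$ is connected. Write $S\Subset O$ if $O$ is open and $\overline S$ is a compact subset of $O$. *Isomonodromic family.* The family (1) is isomonodromic with the distinguished point $\infty$ if every $\boldsymbol t^0\in\mathcal D$ has an open cylindrical neighborhood $\mathcal W\Subset\mathcal D$ such that $M_\gamma(\boldsymbol t')=M_\gamma(\boldsymbol t'')$ for every loop $\gamma$ in $\mathbb{CP}^1\setminus\bigcup_k\overline{\mathcal W_k}$ based at $\infty$ and all $\boldsymbol t',\boldsymbol t''\in\mathcal W$. *Transplants.* Let $E$ be a function on the Riemann surface $\operatorname{cov}(\mathbb C\setminus\{0\};1)$ of $\ln\zeta$. For $a\in\mathbb C$, $p\in\mathbb C\setminus\{a\}$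 and a value $\theta$ of $\arg(p-a)$, the transplant $E(x-a)$ is the function on $\operatorname{cov}(\mathbb C\setminus\{a\};p)$ given by $(x,\beta)\mapsto E\big(x-a,(\beta-a)\cdot\vartheta\big)$, where $\vartheta(s)=e^{(\ln|p-a|+i\theta)s}$, $0\le s\le1$. *Isoprincipal family.* The family (1) is isoprincipal with the distinguished point $\infty$ if for every $\boldsymbol t^0\in\mathcal D$ there are open cylindrical neighborhoods $\mathcal W,\mathcal V$ of $\boldsymbol t^0$ with $\mathcal V\Subset\mathbb C^n_*$ and $\mathcal W\Subset\mathcal V\cap\mathcal D$ such that the following holds. For every $j$, every $p_j\in\mathcal V_j\setminus\overline{\mathcal W_j}$ and every path $\alpha_j$ in $\mathbb{CP}^1\setminus\bigcup_k\overline{\mathcal W_k}$ from $\infty$ to $p_j$ there are a function $E_{\alpha_j}$, holomorphic and invertible on the Riemann surface of $\ln\zeta$, and a branch of $\arg(p_j-t_j)$, continuous in $t_j\in\mathcal W_j$, such that for each $\boldsymbol t\in\mathcal W$ $$Y\big((x,\beta\cdot\alpha_j),\boldsymbol t\big)=H_j(x,\boldsymbol t)\cdot E_{\alpha_j}(x-t_j),\qquad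 (x,\beta)\in\operatorname{cov}(\mathcal V_j\setminus\{t_j\};p_j),$$ where $H_j(\cdot,\boldsymbol t)$ is holomorphic and invertible in the whole of $\mathcal V_j$, and $E_{\alpha_j}(x-t_j)$ is the transplant corresponding to the chosen value of $\arg(p_j-t_j)$. **Theorem.** If the family (1) is isoprincipal with the distinguished point $\infty$, then it is isomonodromic with the distinguished point $\infty$. -/

import Mathlib

open scoped OnePoint Topology

noncomputable section

namespace Fuchsian

/-! ## Points, domains, cylindrical neighbourhoods -/

/-- The extended complex plane `ℂ ∪ {∞}`. -/
abbrev CP1 : Type := OnePoint ℂ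

/-- The points of `ℂⁿ` whose coordinates are pairwise different. -/
def distinctPoints (n : ℕ) : Set (Fin n → ℂ) := {t | ∀ i j, i ≠ j → t i ≠ t j}

/-- The cylindrical set `W₁ × ⋯ × Wₙ`. -/
def cylinder {n : ℕ} (W : Fin n → Set ℂ) : Set (Fin n → ℂ) := {t | ∀ j, t j ∈ W j}

/-- The bases `W₁, …, Wₙ` of an open cylindrical neighbourhood of the point `t`. -/
structure IsOpenCylNhd {n : ℕ} (t : Fin n → ℂ) (W : Fin n → Set ℂ) : Prop where
  isOpen : ∀ j, IsOpen (W j)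
  mem : ∀ j, t j ∈ W j
  simplyConnected : ∀ j, IsSimplyConnected (W j)
  connected_compl : ∀ j, IsConnected (closure (W j))ᶜ

/-- The set `S` is compactly included in the open set `O`. -/
structure CompactlyIncluded {n : ℕ} (S O : Set (Fin n → ℂ)) : Prop where
  isOpen : IsOpen O
  isCompact : IsCompact (closure S)
  subset : closure S ⊆ O

/-- `W, V` are the bases of a nested pair of open cylindrical neighbourhoods of `t₀` in `D`. -/
structure IsNestedPair {n : ℕ} (D : Set (Fin n → ℂ)) (t₀ : Fin n → ℂ)
    (W V : Fin n → Set ℂ) : Prop where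
  nhd_inner : IsOpenCylNhd t₀ W
  nhd_outer : IsOpenCylNhd t₀ V
  outer : CompactlyIncluded (cylinder V) (distinctPoints n)
  inner : CompactlyIncluded (cylinder W) (cylinder V ∩ D)

/-- The punctured sphere `CP¹ ∖ {t₁, …, tₙ}`. -/
def puncturedSphere {n : ℕ} (t : Fin n → ℂ) : Set CP1 := {x | ∀ j, x ≠ (t j : CP1)}

/-- The perforated sphere: the complement in `CP¹` of the union of the closures of the `Wⱼ`. -/
def perforatedSphere {n : ℕ} (W : Fin n → Set ℂ) : Set CP1 :=
  {x | ∀ j, ∀ w ∈ closure (W j), x ≠ (w : CP1)}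

/-- The point `∞` of the punctured sphere. -/
def puncturedInfty {n : ℕ} (t : Fin n → ℂ) : puncturedSphere t :=
  ⟨∞, fun j => OnePoint.infty_ne_coe (t j)⟩

/-- The point `∞` of the perforated sphere. -/
def perforatedInfty {n : ℕ} (W : Fin n → Set ℂ) : perforatedSphere W :=
  ⟨∞, fun _ w _ => OnePoint.infty_ne_coe w⟩

theorem perforated_subset_punctured {n : ℕ} {W : Fin n → Set ℂ} {t : Fin n → ℂ}
    (ht : t ∈ cylinder W) : perforatedSphere W ⊆ puncturedSphere t :=
  fun _ hx j => hx j (t j) (subset_closure (ht j))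

/-! ## Universal covering spaces -/

/-- The universal covering space of `X` with the distinguished point `x₀`: the set of pairs
`(x, α)`, where `α` is a homotopy class (with fixed ends) of paths in `X` from `x₀` to `x`. -/
def Cov {X : Type*} [TopologicalSpace X] (x₀ : X) : Type _ :=
  Σ x : X, Path.Homotopic.Quotient x₀ x

/-- The point `(x, α)` of the universal covering space. -/
def Cov.mk {X : Type*} [TopologicalSpace X] {x₀ : X} (x : X)
    (α : Path.Homotopic.Quotient x₀ x) : Cov x₀ := ⟨x, α⟩

/-- The map of universal covering spaces `(x, α) ↦ (f x, f ∘ α)` induced by a continuous map. -/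
def Cov.map {X Y : Type*} [TopologicalSpace X] [TopologicalSpace Y] {x₀ : X} (f : C(X, Y))
    (P : Cov x₀) : Cov (f x₀) := Cov.mk (f P.1) (P.2.map f)

/-- The map `(x, β) ↦ (x, β · α)`, where `α` is a homotopy class of paths from `x₀` to `x₁`
(first go along `α`, then along `β`). For `x₁ = x₀` this is a deck transformation. -/
def Cov.precomp {X : Type*} [TopologicalSpace X] {x₀ x₁ : X}
    (α : Path.Homotopic.Quotient x₀ x₁) (P : Cov x₁) : Cov x₀ := Cov.mk P.1 (α.trans P.2)

/-- Near the point `P = (x, α)` of the universal covering space the function `F`, written in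
terms of the coordinate function `z` on `X`, is the function `g`:
`F (y, β · α) = g (z y)` for all `y` and all paths `β` from `x` to `y` in a neighbourhood of `x`. -/
def Cov.LocallyEq {X M : Type*} [TopologicalSpace X] {x₀ : X} (z : X → ℂ) (F : Cov x₀ → M)
    (P : Cov x₀) (g : ℂ → M) : Prop :=
  ∃ N ∈ 𝓝 P.1, ∀ (y : X) (β : Path P.1 y), (∀ s, β s ∈ N) →
    F (Cov.mk y (P.2.trans (Path.Homotopic.Quotient.mk β))) = g (z y)

/-- The function `F` on the universal covering space is holomorphic near `P` with respect to the
local coordinate `z`. -/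
def Cov.HolomorphicNear {X M : Type*} [TopologicalSpace X] [AddCommGroup M] [Module ℂ M]
    [TopologicalSpace M] {x₀ : X} (z : X → ℂ) (F : Cov x₀ → M) (P : Cov x₀) : Prop :=
  ∃ g : ℂ → M, Cov.LocallyEq z F P g ∧ ∀ᶠ w in 𝓝 (z P.1), DifferentiableAt ℂ g w

/-! ## Fuchsian systems -/

/-- The coordinate `x` on the finite part of `CP¹` (with an irrelevant value at `∞`). -/
def affineCoord (x : CP1) : ℂ := x.elim 0 id

/-- The coordinate `1 / x` on the part `x ≠ 0` of `CP¹`, equal to `0` at `x = ∞`. -/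
def inftyCoord (x : CP1) : ℂ := x.elim 0 (fun w => w⁻¹)

/-- The coefficient matrix `∑ⱼ Qⱼ / (x - tⱼ)` of a Fuchsian system. -/
def coefficient {n k : ℕ} (t : Fin n → ℂ) (Q : Fin n → Matrix (Fin k) (Fin k) ℂ) (x : ℂ) :
    Matrix (Fin k) (Fin k) ℂ := ∑ j, (x - t j)⁻¹ • Q j

/-- `Y` is the solution of the Fuchsian system `dY/dx = (∑ⱼ Qⱼ / (x - tⱼ)) Y` with the initial
condition `Y = I` at `x = ∞`, as a holomorphic function on the universal covering surface of
`CP¹ ∖ {t₁, …, tₙ}` with the distinguished point `∞`. -/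
structure IsNormalizedSolution {n k : ℕ} (t : Fin n → ℂ) (Q : Fin n → Matrix (Fin k) (Fin k) ℂ)
    (Y : Cov (puncturedInfty t) → Matrix (Fin k) (Fin k) ℂ) : Prop where
  ode : ∀ P : Cov (puncturedInfty t), (P.1 : CP1) ≠ ∞ →
    ∃ g : ℂ → Matrix (Fin k) (Fin k) ℂ, Cov.LocallyEq (fun x : puncturedSphere t => affineCoord x) Y P g ∧
      ∀ᶠ w in 𝓝 (affineCoord P.1), HasDerivAt g (coefficient t Q w * g w) w
  holomorphic_infty : ∀ P : Cov (puncturedInfty t), (P.1 : CP1) = ∞ →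
    Cov.HolomorphicNear (fun x : puncturedSphere t => inftyCoord x) Y P
  normalized : Y (Cov.mk (puncturedInfty t) (Path.Homotopic.Quotient.refl _)) = 1

/-- `M` is the monodromy matrix of `Y` corresponding to the loop `γ`:
`Y (x, α · γ) = Y (x, α) M` on the whole universal covering surface. -/
def IsMonodromyMatrix {n k : ℕ} {t : Fin n → ℂ}
    (Y : Cov (puncturedInfty t) → Matrix (Fin k) (Fin k) ℂ)
    (γ : Path.Homotopic.Quotient (puncturedInfty t) (puncturedInfty t))
    (M : Matrix (Fin k) (Fin k) ℂ) : Prop :=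
  ∀ P : Cov (puncturedInfty t), Y (Cov.precomp γ P) = Y P * M

/-- The branch in the domain `U ⊆ CP¹ ∖ {t₁, …, tₙ}` of the function `Y`, corresponding to the path
`α` from `∞` to the point `p` of `U`: the function `(x, β) ↦ Y (x, β · α)` on the universal
covering surface of `U` with the distinguished point `p`. -/
def branch {n k : ℕ} {t : Fin n → ℂ} (Y : Cov (puncturedInfty t) → Matrix (Fin k) (Fin k) ℂ)
    {U : Set ℂ} (hU : ∀ z ∈ U, (z : CP1) ∈ puncturedSphere t) (p : U)
    (α : Path (puncturedInfty t) ⟨((p : ℂ) : CP1), hU p p.2⟩) (P : Cov p) :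
    Matrix (Fin k) (Fin k) ℂ :=
  Y (Cov.precomp (Path.Homotopic.Quotient.mk α) (Cov.map
    (⟨fun z => ⟨((z : ℂ) : CP1), hU z z.2⟩,
      (OnePoint.continuous_coe.comp continuous_subtype_val).subtype_mk _⟩ :
        C(U, puncturedSphere t)) P))

/-! ## The Riemann surface of the logarithm and transplants -/

/-- The punctured plane `ℂ ∖ {a}`. -/
abbrev PuncturedPlane (a : ℂ) : Type := {z : ℂ // z ≠ a}

/-- The Riemann surface of `ln ζ`: the universal covering surface of `ℂ ∖ {0}` with the
distinguished point `1`. -/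
abbrev LogSurface : Type := Cov (⟨1, one_ne_zero⟩ : PuncturedPlane 0)

/-- `θ` is one of the values of `arg ζ`. -/
def IsArgValue (ζ : ℂ) (θ : ℝ) : Prop := Complex.exp (Real.log ‖ζ‖ + θ * Complex.I) = ζ

/-- The path `s ↦ exp ((ln |ζ| + i θ) s)` in `ℂ ∖ {0}` from `1` to `ζ`, where `θ` is a value of
`arg ζ`. -/
def argPath (ζ : PuncturedPlane 0) (θ : ℝ) (hθ : IsArgValue ζ θ) :
    Path (⟨1, one_ne_zero⟩ : PuncturedPlane 0) ζ where
  toFun s := ⟨Complex.exp ((Real.log ‖(ζ : ℂ)‖ + θ * Complex.I) * ((s : ℝ) : ℂ)),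
    Complex.exp_ne_zero _⟩
  continuous_toFun := by
    refine Continuous.subtype_mk ?_ _
    fun_prop
  source' := by
    apply Subtype.ext
    simp
  target' := by
    apply Subtype.ext
    simpa [IsArgValue] using hθ

/-- The parallel translation `x ↦ x - a` from `ℂ ∖ {a}` to `ℂ ∖ {0}`. -/
def translation (a : ℂ) : C(PuncturedPlane a, PuncturedPlane 0) :=
  ⟨fun x => ⟨(x : ℂ) - a, sub_ne_zero.mpr x.2⟩, by
    refine Continuous.subtype_mk ?_ _
    fun_prop⟩

/-- The transplant `E (x - a)` of the function `E` on the Riemann surface of `ln ζ` into the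
universal covering surface of `ℂ ∖ {a}` with the distinguished point `p`, corresponding to the value
`θ` of `arg (p - a)`. -/
def transplant {M : Type*} (E : LogSurface → M) {a : ℂ} (p : PuncturedPlane a) (θ : ℝ)
    (hθ : IsArgValue ((p : ℂ) - a) θ) (P : Cov p) : M :=
  E (Cov.precomp (Path.Homotopic.Quotient.mk (argPath (translation a p) θ hθ))
    (Cov.map (translation a) P))

/-- The inclusion of `V ∖ {a}` into `ℂ ∖ {a}`. -/
def diffInclusion (V : Set ℂ) (a : ℂ) : C((V \ {a} : Set ℂ), PuncturedPlane a) :=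
  ⟨fun x => ⟨(x : ℂ), x.2.2⟩, continuous_subtype_val.subtype_mk _⟩

/-- A matrix function on the Riemann surface of `ln ζ` is holomorphic and invertible. -/
structure IsHolomorphicInvertible {k : ℕ} (E : LogSurface → Matrix (Fin k) (Fin k) ℂ) : Prop where
  holomorphic : ∀ P, Cov.HolomorphicNear (fun z : PuncturedPlane 0 => (z : ℂ)) E P
  invertible : ∀ P, IsUnit (E P)

/-! ## Families of Fuchsian systems -/

theorem IsNestedPair.diff_subset_punctured {n : ℕ} {D : Set (Fin n → ℂ)} {t₀ : Fin n → ℂ}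
    {W V : Fin n → Set ℂ} (h : IsNestedPair D t₀ W V) {t : Fin n → ℂ} (ht : t ∈ cylinder W)
    (j : Fin n) : ∀ z ∈ V j \ {t j}, (z : CP1) ∈ puncturedSphere t := by
  classical
  intro z hz i hzi
  have hzi' : z = t i := OnePoint.coe_injective hzi
  have htV : t ∈ cylinder V := (h.inner.subset (subset_closure ht)).1
  have hij : j ≠ i := by
    rintro rfl
    exact hz.2 hzi'
  have hu : Function.update t j z ∈ cylinder V := by
    intro l
    by_cases hl : l = j
    · subst hl
      simpa using hz.1
    · simpa [Function.update_of_ne hl] using htV l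
  have := h.outer.subset (subset_closure hu) j i hij
  rw [Function.update_self, Function.update_of_ne hij.symm] at this
  exact this hzi'

theorem mem_diff_singleton {n : ℕ} {t : Fin n → ℂ} {W V : Fin n → Set ℂ}
    (ht : t ∈ cylinder W) {j : Fin n} {p : ℂ} (hp : p ∈ V j \ closure (W j)) :
    p ∈ V j \ {t j} := by
  refine ⟨hp.1, ?_⟩
  rintro rfl
  exact hp.2 (subset_closure (ht j))

/-- The path `α` in the perforated sphere, regarded as a path in the punctured sphere
`CP¹ ∖ {t₁, …, tₙ}`, for `t` in the cylindrical set `W₁ × ⋯ × Wₙ`. -/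
def toPunctured {n : ℕ} {W : Fin n → Set ℂ} {t : Fin n → ℂ} (ht : t ∈ cylinder W)
    {x : CP1} {hx : x ∈ perforatedSphere W} (α : Path (perforatedInfty W) ⟨x, hx⟩) :
    Path (puncturedInfty t) ⟨x, perforated_subset_punctured ht hx⟩ :=
  α.map (continuous_inclusion (perforated_subset_punctured ht))

/-- A holomorphic family of Fuchsian systems, parameterized by the pole loci: the residue matrices
are holomorphic functions of `t` in a domain `D` of points with pairwise different coordinates. -/
structure IsHolomorphicFamily {n k : ℕ} (D : Set (Fin n → ℂ))
    (Q : (Fin n → ℂ) → Fin n → Matrix (Fin k) (Fin k) ℂ) : Prop where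
  isOpen : IsOpen D
  isConnected : IsConnected D
  subset : D ⊆ distinctPoints n
  holomorphic : ∀ j, DifferentiableOn ℂ (fun t => Q t j) D

/-- `Y t` is, for each `t` in `D`, the solution of the system with parameter `t` that is equal to
`I` at `∞`. -/
def IsSolutionFamily {n k : ℕ} (D : Set (Fin n → ℂ))
    (Q : (Fin n → ℂ) → Fin n → Matrix (Fin k) (Fin k) ℂ)
    (Y : ∀ t : Fin n → ℂ, Cov (puncturedInfty t) → Matrix (Fin k) (Fin k) ℂ) : Prop :=
  ∀ t ∈ D, IsNormalizedSolution t (Q t) (Y t)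

/-- The family of Fuchsian systems is isomonodromic with the distinguished point `∞`. -/
def IsIsomonodromic {n k : ℕ} (D : Set (Fin n → ℂ))
    (Q : (Fin n → ℂ) → Fin n → Matrix (Fin k) (Fin k) ℂ) : Prop :=
  ∃ Y : ∀ t : Fin n → ℂ, Cov (puncturedInfty t) → Matrix (Fin k) (Fin k) ℂ,
    IsSolutionFamily D Q Y ∧
    ∀ t₀ ∈ D, ∃ W : Fin n → Set ℂ, IsOpenCylNhd t₀ W ∧ CompactlyIncluded (cylinder W) D ∧
      ∀ (γ : Path (perforatedInfty W) (perforatedInfty W)) (t' t'' : Fin n → ℂ)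
        (ht' : t' ∈ cylinder W) (ht'' : t'' ∈ cylinder W),
        ∃ M : Matrix (Fin k) (Fin k) ℂ,
          IsMonodromyMatrix (Y t') (Path.Homotopic.Quotient.mk (toPunctured ht' γ)) M ∧
          IsMonodromyMatrix (Y t'') (Path.Homotopic.Quotient.mk (toPunctured ht'' γ)) M

/-- The family of Fuchsian systems is isoprincipal with the distinguished point `∞`.

Here `θ` is the branch of `arg (p - τ)`, continuous with respect to `τ` in `W j`, that makes the
family of transplants of `E` coherent. -/
def IsIsoprincipal {n k : ℕ} (D : Set (Fin n → ℂ))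
    (Q : (Fin n → ℂ) → Fin n → Matrix (Fin k) (Fin k) ℂ) : Prop :=
  ∃ Y : ∀ t : Fin n → ℂ, Cov (puncturedInfty t) → Matrix (Fin k) (Fin k) ℂ,
    IsSolutionFamily D Q Y ∧
    ∀ t₀ ∈ D, ∃ (W V : Fin n → Set ℂ) (hWV : IsNestedPair D t₀ W V),
      ∀ (j : Fin n) (p : ℂ) (hp : p ∈ V j \ closure (W j)) (hp' : (p : CP1) ∈ perforatedSphere W)
        (α : Path (perforatedInfty W) ⟨(p : CP1), hp'⟩),
        ∃ E : LogSurface → Matrix (Fin k) (Fin k) ℂ, IsHolomorphicInvertible E ∧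
        ∃ θ : ℂ → ℝ, ContinuousOn θ (W j) ∧
        ∃ hθ : ∀ τ ∈ W j, IsArgValue (p - τ) (θ τ),
        ∀ (t : Fin n → ℂ) (ht : t ∈ cylinder W),
        ∃ H : ℂ → Matrix (Fin k) (Fin k) ℂ,
          DifferentiableOn ℂ H (V j) ∧ (∀ x ∈ V j, IsUnit (H x)) ∧
          ∀ P : Cov (⟨p, mem_diff_singleton ht hp⟩ : (V j \ {t j} : Set ℂ)),
            branch (Y t) (hWV.diff_subset_punctured ht j) _ (toPunctured ht α) P =
              H (P.1 : ℂ) * transplant E (diffInclusion (V j) (t j)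
                ⟨p, mem_diff_singleton ht hp⟩) (θ (t j)) (hθ (t j) (ht j))
                (Cov.map (diffInclusion (V j) (t j)) P)

end Fuchsian

end

/-! ## Locally constant systems of functions in the plane -/

/-! Fix `t'`, `t''` in the inner cylinder and let `r = Y(·, t') · Y(·, t'')⁻¹` on the universal
covering of the perforated sphere. The value of a normalized solution at `(∞, γ)` is the monodromy
matrix of `γ`, so it suffices that `r` takes the same value at `(∞, γ)` as at `(∞, refl)`, namely
`1`. Since both factors acquire constant right factors under deck transformations, two branches of
`r` that agree at one point agree along every continuation (`ratio_eq_iff`).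

Local part. In the annular domain `V j \ closure (W j)` a branch of the solution is `H(x) · E(ln (x
- t j))` with `E` independent of `t`. A loop `δ` at `p` adds a constant `c` (`2πi` times a winding
number) to the logarithm, so the single-valued factor cancels and the local monodromy is `E(u)⁻¹ E(u
+ c)` with `u = ln (p - t j)`. Moving `t j` changes `u` exactly as moving `p` would, and the local
monodromy does not depend on the point where it is computed. Hence it is locally constant in `t j`,
and constant because `W j` is connected (`localMonodromy_eq`). So `r` is unchanged by loops in each
annular domain.

Global part. No generators of the fundamental group are chosen. The branches of `r` over `V j \
closure (W j)` are extended over the hole, which gives a `BranchSystem` on the whole plane; the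
monodromy theorem `exists_global` then yields a global branch. Started from the single-valued branch
near `∞`, it shows that `r` descends to a function on the perforated sphere (`eq_of_loops`). The
annular domains are connected by the unicoherence of the plane, itself an application of
`exists_global`. -/

/-- Induction on closed intervals: a property that is additive under concatenation of intervals and
that holds for all small intervals near each point holds for all intervals. -/
theorem interval_induction {q : ℝ → ℝ → Prop}
    (hadd : ∀ a b c, a ≤ b → b ≤ c → q a b → q b c → q a c)
    (hloc : ∀ x, ∃ ε > 0, ∀ a b, a ≤ b → x - ε < a → b < x + ε → q a b)
    {a b : ℝ} (h : a ≤ b) : q a b := by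
  choose ε hε hq using hloc
  -- Compactness gives a finite monotone subdivision whose pieces each lie in one of the good
  -- neighbourhoods.
  obtain ⟨t, ht0, hmono, ⟨m, hm⟩, hsub⟩ :=
    exists_monotone_Icc_subset_open_cover_Icc h
      (c := fun x : ℝ => {y : Set.Icc a b | x - ε x < y ∧ (y : ℝ) < x + ε x})
      (fun x => (isOpen_lt continuous_const continuous_subtype_val).inter
        (isOpen_lt continuous_subtype_val continuous_const))
      (fun y _ => Set.mem_iUnion.2 ⟨y, by
        have := hε y
        constructor <;> simp [this]⟩)
  have key : ∀ n, q a (t n) := by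
    intro n
    induction n with
    | zero =>
      rw [ht0]
      exact hq a a a le_rfl (by linarith [hε a]) (by linarith [hε a])
    | succ n ih =>
      obtain ⟨x, hx⟩ := hsub n
      have h1 : t n ≤ t (n + 1) := hmono n.le_succ
      refine hadd a (t n) (t (n + 1)) (t n).2.1 h1 ih ?_
      exact hq x _ _ h1 (hx ⟨le_rfl, h1⟩).1 (hx ⟨h1, le_rfl⟩).2
  have := key m
  rwa [hm m le_rfl] at this

/-- A system of functions in open subsets of the plane that behaves as the system of the branches
of a locally constant multivalued function: locally, through each admissible value there passes one
and only one branch. -/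
structure BranchSystem (A : Type*) where
  /-- `Sec U f`: the function `f` is a branch in `U`. -/
  Sec : Set ℂ → (ℂ → A) → Prop
  /-- `Val x a`: the value `a` is admissible at the point `x`. -/
  Val : ℂ → A → Prop
  isOpen : ∀ {U f}, Sec U f → IsOpen U
  exists_nhd : ∀ x, ∃ U ∈ 𝓝 x, ∀ y ∈ U, ∀ a, Val y a → ∃ f, Sec U f ∧ f y = a
  discrete : ∀ {U V f g x}, Sec U f → Sec V g → x ∈ U → x ∈ V →
    ∀ᶠ y in 𝓝 x, (f y = g y ↔ f x = g x)
  val : ∀ {U f y}, Sec U f → y ∈ U → Val y (f y)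

namespace BranchSystem

variable {A : Type*} (B : BranchSystem A)

/-- The function `f` coincides with a branch near each point of the set `S`. -/
def IsBranchOn (S : Set ℂ) (f : ℂ → A) : Prop :=
  ∀ x ∈ S, ∃ U g, B.Sec U g ∧ x ∈ U ∧ ∀ᶠ y in 𝓝[S] x, f y = g y

variable {B}

theorem IsBranchOn.val {S : Set ℂ} {f : ℂ → A} (h : B.IsBranchOn S f) {x : ℂ} (hx : x ∈ S) :
    B.Val x (f x) := by
  obtain ⟨U, g, hg, hxU, he⟩ := h x hx
  rw [he.self_of_nhdsWithin hx]
  exact B.val hg hxU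

theorem IsBranchOn.mono {S T : Set ℂ} {f : ℂ → A} (h : B.IsBranchOn S f) (hTS : T ⊆ S) :
    B.IsBranchOn T f := by
  intro x hx
  obtain ⟨U, g, hg, hxU, he⟩ := h x (hTS hx)
  exact ⟨U, g, hg, hxU, he.filter_mono (nhdsWithin_mono x hTS)⟩

theorem IsBranchOn.eventually_iff {S : Set ℂ} {f g : ℂ → A} (hf : B.IsBranchOn S f)
    (hg : B.IsBranchOn S g) {x : ℂ} (hx : x ∈ S) :
    ∀ᶠ y in 𝓝[S] x, (f y = g y ↔ f x = g x) := by
  obtain ⟨U, φ, hφ, hxU, he⟩ := hf x hx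
  obtain ⟨V, ψ, hψ, hxV, he'⟩ := hg x hx
  have h1 := he.self_of_nhdsWithin hx
  have h2 := he'.self_of_nhdsWithin hx
  filter_upwards [he, he', nhdsWithin_le_nhds (B.discrete hφ hψ hxU hxV)] with y hy hy' hd
  rw [hy, hy', h1, h2, hd]

/-- By `discrete`, both the coincidence set and its complement are relatively open in `S`. -/
theorem IsBranchOn.eqOn {S : Set ℂ} {f g : ℂ → A} (hf : B.IsBranchOn S f)
    (hg : B.IsBranchOn S g) (hS : IsPreconnected S) {x : ℂ} (hx : x ∈ S) (hxe : f x = g x) :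
    Set.EqOn f g S := by
  intro y hy
  have := hS.induction₂ (fun a b => f a = g a ↔ f b = g b) (fun a ha => by
    filter_upwards [hf.eventually_iff hg ha] with b hb using hb.symm)
    (fun a b c _ _ _ h1 h2 => h1.trans h2) (fun a b _ _ h => h.symm) hx hy
  exact this.1 hxe

variable (B) in
/-- Through each admissible value at each point of `S` there passes a branch in `S`. -/
def Extends (S : Set ℂ) : Prop :=
  ∀ x ∈ S, ∀ a, B.Val x a → ∃ f, B.IsBranchOn S f ∧ f x = a

/-- A branch on one set is continued to the other from a single common point; connectedness of the
intersection forces agreement on all of it, so the two pieces glue. Closedness ensures that near a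
point outside one of the sets that set is not seen at all. -/
theorem Extends.union {S T : Set ℂ} (hS : B.Extends S) (hT : B.Extends T) (hSc : IsClosed S)
    (hTc : IsClosed T) (hST : IsConnected (S ∩ T)) : B.Extends (S ∪ T) := by
  classical
  have glue : ∀ {S T : Set ℂ}, B.Extends T → IsClosed S → IsClosed T →
      IsConnected (S ∩ T) → ∀ f, B.IsBranchOn S f → ∃ g, B.IsBranchOn (S ∪ T) g ∧
        ∀ x ∈ S, g x = f x := by
    intro S T hT hSc hTc hST f hf
    obtain ⟨⟨y, hyS, hyT⟩, hpre⟩ := hST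
    obtain ⟨g, hg, hgy⟩ := hT y hyT _ (hf.val hyS)
    have heq : Set.EqOn f g (S ∩ T) := (hf.mono Set.inter_subset_left).eqOn
      (hg.mono Set.inter_subset_right) hpre ⟨hyS, hyT⟩ hgy.symm
    refine ⟨S.piecewise f g, ?_, fun x hx => Set.piecewise_eq_of_mem _ _ _ hx⟩
    have hpT : ∀ y ∈ T, S.piecewise f g y = g y := by
      intro y hy
      by_cases hyS : y ∈ S
      · rw [Set.piecewise_eq_of_mem _ _ _ hyS, heq ⟨hyS, hy⟩]
      · rw [Set.piecewise_eq_of_notMem _ _ _ hyS]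
    have hpS : ∀ y ∈ S, S.piecewise f g y = f y := fun y hy => Set.piecewise_eq_of_mem _ _ _ hy
    intro x hx
    by_cases hxS : x ∈ S
    · obtain ⟨U, φ, hφ, hxU, he⟩ := hf x hxS
      refine ⟨U, φ, hφ, hxU, ?_⟩
      rw [nhdsWithin_union, Filter.eventually_sup]
      constructor
      · filter_upwards [he, self_mem_nhdsWithin] with y hy hyS
        rw [hpS y hyS, hy]
      · by_cases hxT : x ∈ T
        · obtain ⟨V, ψ, hψ, hxV, he'⟩ := hg x hxT
          have h1 := he.self_of_nhdsWithin hxS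
          have h2 := he'.self_of_nhdsWithin hxT
          have h3 : φ x = ψ x := by rw [← h1, ← h2, heq ⟨hxS, hxT⟩]
          filter_upwards [he', self_mem_nhdsWithin,
            nhdsWithin_le_nhds (B.discrete hφ hψ hxU hxV)] with y hy hyT hd
          rw [hpT y hyT, hy, hd.2 h3]
        · have : 𝓝[T] x = ⊥ := by
            rwa [← notMem_closure_iff_nhdsWithin_eq_bot, hTc.closure_eq]
          rw [this]
          exact Filter.eventually_bot
    · have hxT : x ∈ T := hx.resolve_left hxS
      obtain ⟨V, ψ, hψ, hxV, he'⟩ := hg x hxT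
      refine ⟨V, ψ, hψ, hxV, ?_⟩
      rw [nhdsWithin_union, Filter.eventually_sup]
      constructor
      · have : 𝓝[S] x = ⊥ := by
          rwa [← notMem_closure_iff_nhdsWithin_eq_bot, hSc.closure_eq]
        rw [this]
        exact Filter.eventually_bot
      · filter_upwards [he', self_mem_nhdsWithin] with y hy hyT
        rw [hpT y hyT, hy]
  intro x hx a ha
  rcases hx with hx | hx
  · obtain ⟨f, hf, hfx⟩ := hS x hx a ha
    obtain ⟨g, hg, hgf⟩ := glue hT hSc hTc hST f hf
    exact ⟨g, hg, by rw [hgf x hx, hfx]⟩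
  · obtain ⟨f, hf, hfx⟩ := hT x hx a ha
    obtain ⟨g, hg, hgf⟩ := glue hS hTc hSc (by rwa [Set.inter_comm]) f hf
    exact ⟨g, by rwa [Set.union_comm], by rw [hgf x hx, hfx]⟩

theorem isConnected_reProdIm_Icc {a b c d : ℝ} (hab : a ≤ b) (hcd : c ≤ d) :
    IsConnected (Set.Icc a b ×ℂ Set.Icc c d) :=
  ⟨⟨⟨a, c⟩, ⟨le_rfl, hab⟩, ⟨le_rfl, hcd⟩⟩,
    (((convex_Icc a b).is_linear_preimage Complex.reLm.isLinear).inter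
      ((convex_Icc c d).is_linear_preimage Complex.imLm.isLinear)).isPreconnected⟩

theorem isClosed_reProdIm_Icc {a b c d : ℝ} : IsClosed (Set.Icc a b ×ℂ Set.Icc c d) :=
  isClosed_Icc.reProdIm isClosed_Icc

-- Subdivision into small rectangles, each inside a neighbourhood supplied by `exists_nhd`.
-- Neighbouring rectangles meet in a segment, so `Extends.union` applies to each gluing.
variable (B) in
theorem extends_rectangle {a b c d : ℝ} (hab : a ≤ b) (hcd : c ≤ d) :
    B.Extends (Set.Icc a b ×ℂ Set.Icc c d) := by
  -- Thin vertical strips come first: around a fixed abscissa `x` the width `ε` may depend on the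
  -- height interval, and stacking two intervals takes the minimum of the widths.
  have strip : ∀ x : ℝ, ∀ c d : ℝ, c ≤ d → ∃ ε > 0, ∀ a b, a ≤ b → x - ε < a → b < x + ε →
      B.Extends (Set.Icc a b ×ℂ Set.Icc c d) := by
    intro x c d hcd
    refine interval_induction (q := fun c d => ∃ ε > 0, ∀ a b, a ≤ b → x - ε < a → b < x + ε →
      B.Extends (Set.Icc a b ×ℂ Set.Icc c d)) ?_ ?_ hcd
    · rintro c d e hcd hde ⟨ε, hε, h⟩ ⟨δ, hδ, h'⟩
      refine ⟨min ε δ, lt_min hε hδ, fun a b hab ha hb => ?_⟩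
      have h1 := h a b hab (by linarith [min_le_left ε δ]) (by linarith [min_le_left ε δ])
      have h2 := h' a b hab (by linarith [min_le_right ε δ]) (by linarith [min_le_right ε δ])
      have hu : Set.Icc a b ×ℂ Set.Icc c e =
          (Set.Icc a b ×ℂ Set.Icc c d) ∪ (Set.Icc a b ×ℂ Set.Icc d e) := by
        rw [← Set.Icc_union_Icc_eq_Icc hcd hde]
        ext z
        simp only [Complex.mem_reProdIm, Set.mem_union]
        tauto
      have hi : (Set.Icc a b ×ℂ Set.Icc c d) ∩ (Set.Icc a b ×ℂ Set.Icc d e) =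
          Set.Icc a b ×ℂ Set.Icc d d := by
        ext z
        simp only [Complex.mem_reProdIm, Set.mem_inter_iff, Set.mem_Icc]
        constructor
        · rintro ⟨⟨h1, h2⟩, h3, h4⟩
          exact ⟨h1, h4.1, h2.2⟩
        · rintro ⟨h1, h2, h3⟩
          exact ⟨⟨h1, hcd.trans h2, h3⟩, h1, h2, h3.trans hde⟩
      rw [hu]
      refine h1.union h2 isClosed_reProdIm_Icc isClosed_reProdIm_Icc ?_
      rw [hi]
      exact isConnected_reProdIm_Icc hab le_rfl
    · intro y
      obtain ⟨U, hU, h⟩ := B.exists_nhd ⟨x, y⟩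
      obtain ⟨ε, hε, hball⟩ := Metric.mem_nhds_iff.1 hU
      refine ⟨ε / 2, half_pos hε, fun c d hcd hc hd => ⟨ε / 2, half_pos hε,
        fun a b hab ha hb => ?_⟩⟩
      have hsub : Set.Icc a b ×ℂ Set.Icc c d ⊆ U := by
        refine Set.Subset.trans ?_ hball
        rintro z ⟨⟨h1, h2⟩, h3, h4⟩
        rw [Metric.mem_ball, dist_eq_norm]
        refine (Complex.norm_le_abs_re_add_abs_im _).trans_lt ?_
        have h5 : |(z - ⟨x, y⟩ : ℂ).re| < ε / 2 := by
          rw [Complex.sub_re, abs_lt]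
          constructor <;> dsimp <;> linarith
        have h6 : |(z - ⟨x, y⟩ : ℂ).im| < ε / 2 := by
          rw [Complex.sub_im, abs_lt]
          constructor <;> dsimp <;> linarith
        linarith
      intro z hz α hα
      obtain ⟨f, hf, hfz⟩ := h z (hsub hz) α hα
      exact ⟨f, fun w hw => ⟨U, f, hf, hsub hw, Filter.Eventually.of_forall fun _ => rfl⟩, hfz⟩
  refine interval_induction (q := fun a b => B.Extends (Set.Icc a b ×ℂ Set.Icc c d)) ?_
    (fun x => strip x c d hcd) hab
  intro a b e hab hbe h1 h2
  have hu : Set.Icc a e ×ℂ Set.Icc c d =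
      (Set.Icc a b ×ℂ Set.Icc c d) ∪ (Set.Icc b e ×ℂ Set.Icc c d) := by
    rw [← Set.Icc_union_Icc_eq_Icc hab hbe]
    ext z
    simp only [Complex.mem_reProdIm, Set.mem_union]
    tauto
  have hi : (Set.Icc a b ×ℂ Set.Icc c d) ∩ (Set.Icc b e ×ℂ Set.Icc c d) =
      Set.Icc b b ×ℂ Set.Icc c d := by
    ext z
    simp only [Complex.mem_reProdIm, Set.mem_inter_iff, Set.mem_Icc]
    constructor
    · rintro ⟨⟨h1, h2⟩, h3, h4⟩
      exact ⟨⟨h3.1, h1.2⟩, h2⟩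
    · rintro ⟨⟨h1, h2⟩, h3⟩
      exact ⟨⟨⟨hab.trans h1, h2⟩, h3⟩, ⟨h1, h2.trans hbe⟩, h3⟩
  rw [hu]
  refine h1.union h2 isClosed_reProdIm_Icc isClosed_reProdIm_Icc ?_
  rw [hi]
  exact isConnected_reProdIm_Icc le_rfl hcd

variable (B) in
/-- The monodromy theorem in the plane: through each admissible value there passes a global
branch. -/
theorem exists_global (x₀ : ℂ) (a₀ : A) (h : B.Val x₀ a₀) :
    ∃ f, B.IsBranchOn Set.univ f ∧ f x₀ = a₀ := by
  -- An exhaustion by squares, all containing `x₀`; the branches through `a₀` on them are compatible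
  -- by uniqueness.
  set R : ℕ → Set ℂ := fun n =>
    Set.Icc (-(‖x₀‖ + n)) (‖x₀‖ + n) ×ℂ Set.Icc (-(‖x₀‖ + n)) (‖x₀‖ + n) with hR
  have hpos : ∀ n : ℕ, -(‖x₀‖ + n) ≤ ‖x₀‖ + n := fun n => by
    have : 0 ≤ ‖x₀‖ + n := by positivity
    linarith
  have hconn : ∀ n, IsPreconnected (R n) := fun n =>
    (isConnected_reProdIm_Icc (hpos n) (hpos n)).isPreconnected
  have hmem : ∀ (n : ℕ) (z : ℂ), ‖z‖ ≤ ‖x₀‖ + n → z ∈ R n := by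
    intro n z hz
    have h1 := abs_le.1 ((Complex.abs_re_le_norm z).trans hz)
    have h2 := abs_le.1 ((Complex.abs_im_le_norm z).trans hz)
    exact ⟨h1, h2⟩
  have hx₀ : ∀ n, x₀ ∈ R n := fun n => hmem n x₀ (by simp)
  have hmono : ∀ m n : ℕ, m ≤ n → R m ⊆ R n := by
    intro m n hmn z hz
    have : (m : ℝ) ≤ n := by exact_mod_cast hmn
    obtain ⟨⟨h1, h2⟩, h3, h4⟩ := hz
    exact ⟨⟨by linarith, by linarith⟩, by linarith, by linarith⟩
  choose f hf hfx using fun n => B.extends_rectangle (hpos n) (hpos n) x₀ (hx₀ n) a₀ h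
  have hagree : ∀ m n : ℕ, m ≤ n → Set.EqOn (f m) (f n) (R m) := fun m n hmn =>
    (hf m).eqOn ((hf n).mono (hmono m n hmn)) (hconn m) (hx₀ m) ((hfx m).trans (hfx n).symm)
  have hceil : ∀ z : ℂ, z ∈ R ⌈‖z‖⌉₊ := fun z => hmem _ z (by
    have := Nat.le_ceil ‖z‖
    have := norm_nonneg x₀
    linarith)
  -- The index `⌈‖z‖⌉₊` picks a square containing `z`; by compatibility the choice is immaterial, so
  -- near a point it can be replaced by a fixed `n`.
  refine ⟨fun z => f ⌈‖z‖⌉₊ z, ?_, hfx _⟩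
  intro x _
  obtain ⟨n, hn⟩ := exists_nat_gt ‖x‖
  have hev : ∀ᶠ y in 𝓝 x, y ∈ R n ∧ f ⌈‖y‖⌉₊ y = f n y := by
    filter_upwards [(continuous_norm.tendsto x).eventually (gt_mem_nhds hn)] with y hy
    refine ⟨hmem n y (by have := norm_nonneg x₀; linarith), ?_⟩
    exact hagree _ _ (Nat.ceil_le.2 hy.le) (hceil y)
  obtain ⟨U, g, hg, hxU, he⟩ := hf n x hev.self_of_nhds.1
  refine ⟨U, g, hg, hxU, ?_⟩
  rw [nhdsWithin_univ]
  filter_upwards [hev, eventually_nhdsWithin_iff.1 he] with y hy hy'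
  rw [hy.2, hy' hy.1]

end BranchSystem

/-! ### Unicoherence of the plane -/

/-- The plane is unicoherent: the intersection of two connected open sets that cover it is
connected. -/
theorem isPreconnected_inter_of_union_eq_univ {V O : Set ℂ} (hV : IsOpen V) (hO : IsOpen O)
    (hVc : IsPreconnected V) (hOc : IsPreconnected O) (h : V ∪ O = Set.univ) :
    IsPreconnected (V ∩ O) := by
  classical
  rw [isPreconnected_iff_subset_of_disjoint]
  intro S T hS hT hsub hdis
  by_contra! hcon
  have hex : (∃ x ∈ V ∩ O, x ∈ S ∧ x ∉ T) ∧ ∃ y ∈ V ∩ O, y ∈ T ∧ y ∉ S := by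
    obtain ⟨⟨y, hy, hyS⟩, ⟨x, hx, hxT⟩⟩ := And.imp Set.not_subset.1 Set.not_subset.1 hcon
    exact ⟨⟨x, hx, (hsub hx).resolve_right hxT, hxT⟩, ⟨y, hy, (hsub hy).resolve_left hyS, hyS⟩⟩
  obtain ⟨⟨x, hx, hxS, -⟩, y, hy, hyT, hyS⟩ := hex
  -- If `S` and `T` disconnect `V ∩ O`, then `φ` is a nonconstant locally constant integer cocycle
  -- for the cover `V`, `O`.
  set φ : ℂ → ℤ := fun z => if z ∈ V ∩ O ∩ S then 1 else 0 with hφ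
  have hφloc : ∀ z ∈ V ∩ O, ∀ᶠ w in 𝓝 z, φ w = φ z := by
    intro z hz
    rcases hsub hz with hzS | hzT
    · filter_upwards [((hV.inter hO).inter hS).mem_nhds ⟨hz, hzS⟩] with w hw
      rw [hφ]
      simp only [if_pos hw, if_pos (show z ∈ V ∩ O ∩ S from ⟨hz, hzS⟩)]
    · filter_upwards [((hV.inter hO).inter hT).mem_nhds ⟨hz, hzT⟩] with w hw
      have h1 : ∀ w, w ∈ V ∩ O → w ∈ T → w ∉ V ∩ O ∩ S := by
        rintro w hw hwT ⟨_, hwS⟩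
        exact (hdis ▸ (⟨hw, hwS, hwT⟩ : w ∈ V ∩ O ∩ (S ∩ T)) : w ∈ (∅ : Set ℂ))
      rw [hφ]
      simp only [if_neg (h1 w hw.1 hw.2), if_neg (h1 z hz hzT)]
  -- The integer torsor defined by `φ`: its sections are constants over `V` and constants plus `φ`
  -- over `O`. A global branch trivializes the cocycle.
  let B : BranchSystem ℤ :=
    { Sec := fun U f => (U = V ∧ ∃ n, ∀ z, f z = n) ∨ (U = O ∧ ∃ n, ∀ z, f z = n + φ z)
      Val := fun _ _ => True
      isOpen := by rintro U f (⟨rfl, -⟩ | ⟨rfl, -⟩) <;> assumption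
      exists_nhd := by
        intro x
        rcases (h ▸ Set.mem_univ x : x ∈ V ∪ O) with hx | hx
        · exact ⟨V, hV.mem_nhds hx, fun y _ a _ => ⟨fun _ => a, Or.inl ⟨rfl, a, fun _ => rfl⟩, rfl⟩⟩
        · exact ⟨O, hO.mem_nhds hx, fun y _ a _ => ⟨fun z => a - φ y + φ z,
            Or.inr ⟨rfl, a - φ y, fun _ => rfl⟩, by ring⟩⟩
      discrete := by
        rintro U U' f g x (⟨rfl, n, hn⟩ | ⟨rfl, n, hn⟩) (⟨rfl, m, hm⟩ | ⟨rfl, m, hm⟩) hx hx'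
        · simp [hn, hm]
        · filter_upwards [hφloc x ⟨hx, hx'⟩] with y hy
          simp [hn, hm, hy]
        · filter_upwards [hφloc x ⟨hx', hx⟩] with y hy
          simp [hn, hm, hy]
        · simp [hn, hm]
      val := fun _ _ => trivial }
  obtain ⟨f, hf, -⟩ := B.exists_global 0 0 trivial
  have hfV : ∀ z ∈ V, ∀ᶠ w in 𝓝 z, f w = f z := by
    intro z hz
    obtain ⟨U, g, hg, hzU, he⟩ := hf z (Set.mem_univ z)
    rw [nhdsWithin_univ] at he
    have h0 := he.self_of_nhds
    rcases hg with ⟨rfl, n, hn⟩ | ⟨rfl, n, hn⟩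
    · filter_upwards [he] with w hw
      rw [hw, h0, hn, hn]
    · filter_upwards [he, hφloc z ⟨hz, hzU⟩] with w hw hw'
      rw [hw, h0, hn, hn, hw']
  have hfO : ∀ z ∈ O, ∀ᶠ w in 𝓝 z, f w - φ w = f z - φ z := by
    intro z hz
    obtain ⟨U, g, hg, hzU, he⟩ := hf z (Set.mem_univ z)
    rw [nhdsWithin_univ] at he
    have h0 := he.self_of_nhds
    rcases hg with ⟨rfl, n, hn⟩ | ⟨rfl, n, hn⟩
    · filter_upwards [he, hφloc z ⟨hzU, hz⟩] with w hw hw'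
      rw [hw, h0, hn, hn, hw']
    · filter_upwards [he] with w hw
      rw [hw, h0, hn, hn]
      ring
  -- The global branch `f` is constant on `V` and `f - φ` is constant on `O`, so `φ x = φ y`,
  -- against `φ x = 1` and `φ y = 0`.
  have h1 : f x = f y := hVc.induction₂ (fun a b => f a = f b)
    (fun a ha => nhdsWithin_le_nhds ((hfV a ha).mono fun _ h => h.symm))
    (fun a b c _ _ _ h1 h2 => h1.trans h2) (fun a b _ _ h => h.symm) hx.1 hy.1
  have h2 : f x - φ x = f y - φ y := hOc.induction₂ (fun a b => f a - φ a = f b - φ b)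
    (fun a ha => nhdsWithin_le_nhds ((hfO a ha).mono fun _ h => h.symm))
    (fun a b c _ _ _ h1 h2 => h1.trans h2) (fun a b _ _ h => h.symm) hx.2 hy.2
  have h3 : φ x = 1 := if_pos ⟨hx, hxS⟩
  have h4 : φ y = 0 := if_neg fun h => hyS h.2
  omega

/-! ### Continuation along paths and uniqueness for linear equations -/

namespace Fuchsian

/-- Induction along paths: a property of the points of the universal covering space that is locally
constant along paths holds either everywhere or nowhere. -/
theorem Cov.iff_of_locally_iff {X : Type*} [TopologicalSpace X] {x₀ : X} {p : Cov x₀ → Prop}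
    (h : ∀ P : Cov x₀, ∃ N ∈ 𝓝 P.1, ∀ (y : X) (β : Path P.1 y), (∀ s, β s ∈ N) →
      (p (Cov.mk y (P.2.trans (Path.Homotopic.Quotient.mk β))) ↔ p P)) (P : Cov x₀) :
    p P ↔ p (Cov.mk x₀ (Path.Homotopic.Quotient.refl x₀)) := by
  obtain ⟨x, α⟩ := P
  induction α using Path.Homotopic.Quotient.ind with | mk γ =>
  rcases γ with ⟨f, h0, h1⟩
  change f 0 = x₀ at h0
  change f 1 = x at h1
  subst h0 h1
  set γ : Path (f 0) (f 1) := ⟨f, rfl, rfl⟩ with hγ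
  -- The property is followed along the initial pieces of the path; it is locally constant in the
  -- parameter, hence constant on the interval.
  set q : unitInterval → Prop := fun s =>
    p (Cov.mk (f s) (Path.Homotopic.Quotient.mk (γ.subpath 0 s))) with hq
  have hloc : ∀ s, ∀ᶠ s' in 𝓝 s, (q s' ↔ q s) := by
    intro s
    obtain ⟨N, hN, hβ⟩ := h (Cov.mk (f s) (Path.Homotopic.Quotient.mk (γ.subpath 0 s)))
    have hN' : N ∈ 𝓝 (f s) := hN
    have hpre : f ⁻¹' N ∈ 𝓝 s := f.continuous.continuousAt hN'
    obtain ⟨ε, hε, hball⟩ := Metric.mem_nhds_iff.1 hpre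
    filter_upwards [Metric.ball_mem_nhds s hε] with s' hs'
    have h2 := hβ (f s') (γ.subpath s s') (fun u => by
      have hu : γ.subpath s s' u ∈ γ '' (Set.uIcc s s') := by
        rw [← Path.range_subpath]
        exact ⟨u, rfl⟩
      obtain ⟨v, hv, hvu⟩ := hu
      refine Set.mem_of_eq_of_mem (y := γ v) hvu.symm ?_
      refine hball ?_
      rw [Metric.mem_ball] at hs' ⊢
      refine lt_of_le_of_lt ?_ hs'
      have := Set.abs_sub_left_of_mem_uIcc (a := (s : ℝ)) (b := s') (c := v) (by
        rcases Set.mem_uIcc.1 hv with h | h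
        · exact Set.mem_uIcc.2 (Or.inl h)
        · exact Set.mem_uIcc.2 (Or.inr h))
      rw [Subtype.dist_eq, Subtype.dist_eq, Real.dist_eq, Real.dist_eq]
      exact this)
    have h3 : Path.Homotopic.Quotient.mk (γ.subpath 0 s') =
        (Path.Homotopic.Quotient.mk (γ.subpath 0 s)).trans
          (Path.Homotopic.Quotient.mk (γ.subpath s s')) := by
      rw [← Path.Homotopic.Quotient.mk_trans, Path.Homotopic.Quotient.eq]
      exact ⟨(Path.Homotopy.subpathTransSubpath γ 0 s s').symm⟩
    change p (Cov.mk (f s') (Path.Homotopic.Quotient.mk (γ.subpath 0 s'))) ↔ _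
    rw [h3]
    exact h2
  have h01 : q 1 ↔ q 0 := isPreconnected_univ.induction₂ (fun a b : unitInterval => (q b ↔ q a))
    (fun a _ => by rw [nhdsWithin_univ]; exact hloc a)
    (fun a b c _ _ _ h1 h2 => h2.trans h1) (fun a b _ _ h => h.symm) (Set.mem_univ 0)
    (Set.mem_univ 1)
  have hq1 : γ.subpath 0 1 = γ := by
    rw [Path.subpath_zero_one]; rfl
  have hq0 : γ.subpath 0 0 = Path.refl (f 0) := Path.subpath_self γ 0
  simp only [hq, hq1, hq0] at h01
  exact h01

section Norm

attribute [local instance] Matrix.linftyOpNormedRing Matrix.linftyOpNormedAlgebra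

/-- Uniqueness for linear differential equations in a disc. -/
theorem eq_zero_of_hasDerivAt_mul {k : ℕ} {G B : ℂ → Matrix (Fin k) (Fin k) ℂ} {c : ℂ} {ρ : ℝ}
    (hB : ContinuousOn B (Metric.ball c ρ))
    (hG : ∀ z ∈ Metric.ball c ρ, HasDerivAt G (B z * G z) z) {z₁ z₂ : ℂ}
    (h₁ : z₁ ∈ Metric.ball c ρ) (h₂ : z₂ ∈ Metric.ball c ρ) (h : G z₁ = 0) : G z₂ = 0 := by
  set ℓ : ℝ → ℂ := fun s => z₁ + s * (z₂ - z₁) with hℓ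
  have hℓmem : ∀ s ∈ Set.Icc (0 : ℝ) 1, ℓ s ∈ Metric.ball c ρ := by
    intro s hs
    have := (convex_ball c ρ).add_smul_sub_mem h₁ h₂ hs
    simpa [hℓ] using this
  have hℓcont : Continuous ℓ := by fun_prop
  have hℓd : ∀ s, HasDerivAt ℓ (z₂ - z₁) s := by
    intro s
    have := ((Complex.ofRealCLM.hasDerivAt (x := s)).mul_const (z₂ - z₁)).const_add z₁
    simpa [hℓ] using this
  obtain ⟨K, hK⟩ := isCompact_Icc.exists_bound_of_continuousOn
    (hB.comp hℓcont.continuousOn hℓmem)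
  have hd : ∀ s ∈ Set.Icc (0 : ℝ) 1, HasDerivAt (fun s => G (ℓ s))
      ((z₂ - z₁) • (B (ℓ s) * G (ℓ s))) s := fun s hs =>
    HasDerivAt.scomp s (hG _ (hℓmem s hs)) (hℓd s)
  -- Grönwall's inequality along the segment from `z₁` to `z₂`, where the coefficient is bounded by
  -- compactness.
  have := eq_zero_of_abs_deriv_le_mul_abs_self_of_eq_zero_right (f := fun s => G (ℓ s))
    (f' := fun s => (z₂ - z₁) • (B (ℓ s) * G (ℓ s))) (K := ‖z₂ - z₁‖ * K) (a := 0) (b := 1)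
    (fun s hs => (hd s hs).continuousAt.continuousWithinAt)
    (fun s hs => (hd s (Set.Ico_subset_Icc_self hs)).hasDerivWithinAt)
    (by simpa [hℓ] using h)
    (fun s hs => by
      rw [norm_smul, mul_assoc]
      refine mul_le_mul_of_nonneg_left ?_ (norm_nonneg _)
      exact (norm_mul_le _ _).trans (mul_le_mul_of_nonneg_right
        (hK s (Set.Ico_subset_Icc_self hs)) (norm_nonneg _)))
    1 (by simp)
  simpa [hℓ] using this

/-- If a linear differential equation is satisfied by a holomorphic function in a punctured disc,
and both its coefficient and the function are continuous at the centre, then the equation is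
satisfied at the centre. -/
theorem hasDerivAt_of_punctured {k : ℕ} {G B : ℂ → Matrix (Fin k) (Fin k) ℂ} {c : ℂ}
    (hB : ContinuousAt B c) (hd : ∀ᶠ z in 𝓝 c, DifferentiableAt ℂ G z)
    (hG : ∀ᶠ z in 𝓝[≠] c, HasDerivAt G (B z * G z) z) : HasDerivAt G (B c * G c) c := by
  have han : AnalyticAt ℂ G c := Complex.analyticAt_iff_eventually_differentiableAt.2 hd
  have h1 : Filter.Tendsto (deriv G) (𝓝[≠] c) (𝓝 (deriv G c)) :=
    han.deriv.continuousAt.tendsto.mono_left nhdsWithin_le_nhds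
  have h2 : Filter.Tendsto (fun z => B z * G z) (𝓝[≠] c) (𝓝 (B c * G c)) :=
    (hB.mul han.continuousAt).tendsto.mono_left nhdsWithin_le_nhds
  -- Holomorphy makes `deriv G` continuous at `c`, so both sides of the equation have the same limit
  -- there.
  have h3 : deriv G c = B c * G c := tendsto_nhds_unique
    (h1.congr' (hG.mono fun z hz => hz.deriv)) h2
  rw [← h3]
  exact hd.self_of_nhds.hasDerivAt

end Norm

/-! ## Paths in subsets of the sphere -/

/-- The inclusion of a plane set into a subset of the sphere. -/
def coeMap {S : Set CP1} {U : Set ℂ} (h : ∀ z ∈ U, (z : CP1) ∈ S) : C(U, S) :=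
  ⟨fun z => ⟨((z : ℂ) : CP1), h z z.2⟩,
    (OnePoint.continuous_coe.comp continuous_subtype_val).subtype_mk _⟩

theorem exists_path_coe {S : Set CP1} {U : Set ℂ} (hU : IsPathConnected U)
    (h : ∀ z ∈ U, (z : CP1) ∈ S) {w w' : ℂ} (hw : w ∈ U) (hw' : w' ∈ U) :
    ∃ β : Path (⟨w, h w hw⟩ : S) ⟨w', h w' hw'⟩, ∀ s, ∃ z ∈ U, (β s : CP1) = z := by
  have := isPathConnected_iff_pathConnectedSpace.1 hU
  let β := PathConnectedSpace.somePath (⟨w, hw⟩ : U) ⟨w', hw'⟩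
  exact ⟨β.map (coeMap h).continuous, fun s => ⟨β s, (β s).2, rfl⟩⟩

theorem exists_path_infty {S : Set CP1} (hS : ∞ ∈ S) {R : ℝ} (hR : 0 ≤ R)
    (h : ∀ z : ℂ, R < ‖z‖ → (z : CP1) ∈ S) {w : ℂ} (hw : R < ‖w‖) :
    ∃ β : Path (⟨∞, hS⟩ : S) ⟨w, h w hw⟩,
      ∀ s, (β s : CP1) = ∞ ∨ ∃ z : ℂ, R < ‖z‖ ∧ (β s : CP1) = z := by
  classical
  have hw0 : w ≠ 0 := norm_pos_iff.1 (hR.trans_lt hw)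
  -- The radial path `s ↦ w / s`, which starts at `∞` and never comes closer to the origin than `w`.
  let f : unitInterval → CP1 := fun s => if (s : ℝ) = 0 then ∞ else ((w / (s : ℝ) : ℂ) : CP1)
  have hf : ∀ s, f s = ∞ ∨ ∃ z : ℂ, R < ‖z‖ ∧ f s = z := by
    intro s
    by_cases hs : (s : ℝ) = 0
    · exact Or.inl (if_pos hs)
    · refine Or.inr ⟨w / (s : ℝ), ?_, if_neg hs⟩
      have hpos : 0 < (s : ℝ) := lt_of_le_of_ne s.2.1 (Ne.symm hs)
      rw [norm_div, Complex.norm_real, Real.norm_of_nonneg hpos.le]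
      exact hw.trans_le (le_div_self (norm_nonneg w) hpos s.2.2)
  have hfS : ∀ s, f s ∈ S := by
    intro s
    rcases hf s with h1 | ⟨z, hz, h1⟩
    · rwa [h1]
    · rw [h1]
      exact h z hz
  have hfc : Continuous f := by
    rw [continuous_iff_continuousAt]
    intro s
    by_cases hs : (s : ℝ) = 0
    · have h0 : f s = ∞ := if_pos hs
      rw [ContinuousAt, h0, OnePoint.hasBasis_nhds_infty.tendsto_right_iff]
      rintro K ⟨-, hK⟩
      obtain ⟨C, hC⟩ := hK.isBounded.exists_norm_le
      have hev : ∀ᶠ u : unitInterval in 𝓝 s, (u : ℝ) * (|C| + 1) < ‖w‖ := by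
        have hc : Continuous fun u : unitInterval => (u : ℝ) * (|C| + 1) := by fun_prop
        refine (hc.tendsto s).eventually (gt_mem_nhds ?_)
        rw [hs, zero_mul]
        exact norm_pos_iff.2 hw0
      filter_upwards [hev] with u hu
      by_cases hu0 : (u : ℝ) = 0
      · exact Or.inr (if_pos hu0)
      · refine Or.inl ⟨w / (u : ℝ), fun hmem => ?_, (if_neg hu0).symm⟩
        have hpos : 0 < (u : ℝ) := lt_of_le_of_ne u.2.1 (Ne.symm hu0)
        have h1 := hC _ hmem
        rw [norm_div, Complex.norm_real, Real.norm_of_nonneg hpos.le, div_le_iff₀ hpos] at h1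
        nlinarith [le_abs_self C]
    · have h1 : f =ᶠ[𝓝 s] fun u => ((w / (u : ℝ) : ℂ) : CP1) := by
        filter_upwards [(continuous_subtype_val.tendsto s).eventually (isOpen_ne.mem_nhds hs)]
          with u hu using if_neg hu
      refine ContinuousAt.congr ?_ h1.symm
      refine OnePoint.continuous_coe.continuousAt.comp ?_
      exact continuousAt_const.div
        (Complex.continuous_ofReal.comp continuous_subtype_val).continuousAt
        (by exact_mod_cast hs)
  refine ⟨⟨⟨fun s => ⟨f s, hfS s⟩, hfc.subtype_mk _⟩, ?_, ?_⟩, hf⟩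
  · exact Subtype.ext (if_pos rfl)
  · refine Subtype.ext ?_
    change f 1 = _
    simp [f]

theorem exists_radius_of_mem_nhds_infty {S : Set CP1} (hS : ∞ ∈ S) {N : Set S}
    (hN : N ∈ 𝓝 (⟨∞, hS⟩ : S)) :
    ∃ R : ℝ, 0 ≤ R ∧ ∀ x : S, ((x : CP1) = ∞ ∨ ∃ z : ℂ, R < ‖z‖ ∧ (x : CP1) = z) → x ∈ N := by
  obtain ⟨M, hM, hMN⟩ := mem_nhds_subtype _ _ _ |>.1 hN
  have h1 : ((↑) : ℂ → CP1) ⁻¹' M ∈ Bornology.cobounded ℂ := by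
    rw [Metric.cobounded_eq_cocompact, ← Filter.coclosedCompact_eq_cocompact,
      ← OnePoint.comap_coe_nhds_infty]
    exact Filter.preimage_mem_comap hM
  obtain ⟨R, -, hR⟩ := (Metric.hasBasis_cobounded_compl_closedBall (0 : ℂ)).mem_iff.1 h1
  refine ⟨max R 0, le_max_right _ _, ?_⟩
  rintro x (hx | ⟨z, hz, hx⟩)
  · exact hMN (show (x : CP1) ∈ M from hx ▸ mem_of_mem_nhds hM)
  · refine hMN (show (x : CP1) ∈ M from ?_)
    rw [hx]
    refine hR ?_
    rw [Set.mem_compl_iff, mem_closedBall_zero_iff, not_le]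
    exact (le_max_left _ _).trans_lt hz

theorem eq_coe_affineCoord {x : CP1} (hx : x ≠ ∞) : x = ((affineCoord x : ℂ) : CP1) := by
  induction x using OnePoint.rec with
  | infty => exact absurd rfl hx
  | coe z => rfl

theorem continuousAt_affineCoord {x : CP1} (hx : x ≠ ∞) : ContinuousAt affineCoord x := by
  induction x using OnePoint.rec with
  | infty => exact absurd rfl hx
  | coe z =>
    rw [← OnePoint.isOpenEmbedding_coe.continuousAt_iff (f := ((↑) : ℂ → OnePoint ℂ))]
    exact continuousAt_id

theorem continuousAt_inftyCoord : ContinuousAt inftyCoord ∞ := by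
  rw [ContinuousAt, OnePoint.tendsto_nhds_infty']
  refine ⟨tendsto_pure_nhds _ _, ?_⟩
  rw [Filter.coclosedCompact_eq_cocompact, ← Metric.cobounded_eq_cocompact]
  exact Filter.tendsto_inv₀_cobounded

theorem puncturedSphere_of_lt_norm {n : ℕ} (t : Fin n → ℂ) {z : ℂ} (hz : ∑ j, ‖t j‖ < ‖z‖) :
    (z : CP1) ∈ puncturedSphere t := by
  intro j hj
  have h1 : z = t j := OnePoint.coe_injective hj
  rw [h1] at hz
  exact absurd (Finset.single_le_sum (f := fun j => ‖t j‖) (fun i _ => norm_nonneg _)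
    (Finset.mem_univ j)) (not_le.2 hz)

/-! ## Solutions of a Fuchsian system on the universal covering surface -/

open Classical in
/-- A function on the universal covering surface that is, near each point, a solution of the
Fuchsian system. -/
def IsSolution {n k : ℕ} (t : Fin n → ℂ) (Q : Fin n → Matrix (Fin k) (Fin k) ℂ)
    (F : Cov (puncturedInfty t) → Matrix (Fin k) (Fin k) ℂ) : Prop :=
  ∀ P : Cov (puncturedInfty t), ∃ (z : puncturedSphere t → ℂ) (g B : ℂ → Matrix (Fin k) (Fin k) ℂ),
    z = (if (P.1 : CP1) = ∞ then fun x : puncturedSphere t => inftyCoord x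
      else fun x : puncturedSphere t => affineCoord x) ∧
    B = (if (P.1 : CP1) = ∞ then fun w => -∑ j, (t j * (1 - t j * w)⁻¹) • Q j
      else coefficient t Q) ∧
    Cov.LocallyEq z F P g ∧ ∀ᶠ w in 𝓝 (z P.1), HasDerivAt g (B w * g w) w

theorem Cov.mk_trans_refl {X : Type*} [TopologicalSpace X] {x₀ : X} (P : Cov x₀) :
    Cov.mk P.1 (P.2.trans (Path.Homotopic.Quotient.mk (Path.refl P.1))) = P := by
  rw [Path.Homotopic.Quotient.mk_refl, Path.Homotopic.Quotient.trans_refl]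
  rfl

/-- The coefficient of the system in the coordinate `z = 1/x`. Each term contributes a pole `-z⁻¹ •
Q j` at the origin, and these cancel since the residues sum to zero: `∞` is a regular point. -/
theorem coefficient_inv_eq {n k : ℕ} {t : Fin n → ℂ} {Q : Fin n → Matrix (Fin k) (Fin k) ℂ}
    (hsum : ∑ j, Q j = 0) {z : ℂ} (hz : z ≠ 0) (hz' : ∀ j, 1 - t j * z ≠ 0) :
    (-(z ^ 2)⁻¹) • coefficient t Q z⁻¹ = -∑ j, (t j * (1 - t j * z)⁻¹) • Q j := by
  have h1 : ∀ j, (-(z ^ 2)⁻¹ * (z⁻¹ - t j)⁻¹) = -z⁻¹ - t j * (1 - t j * z)⁻¹ := by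
    intro j
    have h2 : z⁻¹ - t j ≠ 0 := by
      intro h
      apply hz' j
      rw [← sub_eq_zero.1 h, inv_mul_cancel₀ hz, sub_self]
    have := hz' j
    have h3 : (z⁻¹ - t j)⁻¹ = z * (1 - t j * z)⁻¹ := by
      rw [← inv_inv z, ← mul_inv, inv_inv]
      congr 1
      field_simp
    have h4 : 1 - z * t j ≠ 0 := by rwa [mul_comm]
    rw [h3]
    field_simp
    ring
  rw [coefficient, Finset.smul_sum]
  simp_rw [smul_smul, h1, sub_smul]
  rw [Finset.sum_sub_distrib, ← Finset.smul_sum, hsum, smul_zero, zero_sub]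

section Norm

attribute [local instance] Matrix.linftyOpNormedRing Matrix.linftyOpNormedAlgebra

theorem continuousAt_coefficient {n k : ℕ} {t : Fin n → ℂ}
    (Q : Fin n → Matrix (Fin k) (Fin k) ℂ) {w : ℂ} (hw : ∀ j, w - t j ≠ 0) :
    ContinuousAt (coefficient t Q) w := by
  refine tendsto_finsetSum _ fun j _ => ?_
  have h : ContinuousAt (fun w : ℂ => (w - t j)⁻¹) w := ContinuousAt.inv₀ (by fun_prop) (hw j)
  exact h.tendsto.smul tendsto_const_nhds

theorem continuousAt_coefficient_infty {n k : ℕ} {t : Fin n → ℂ}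
    (Q : Fin n → Matrix (Fin k) (Fin k) ℂ) {w : ℂ} (hw : ∀ j, 1 - t j * w ≠ 0) :
    ContinuousAt (fun w => -∑ j, (t j * (1 - t j * w)⁻¹) • Q j) w := by
  refine ContinuousAt.neg (tendsto_finsetSum _ fun j _ => ?_)
  have h : ContinuousAt (fun w : ℂ => t j * (1 - t j * w)⁻¹) w :=
    continuousAt_const.mul (ContinuousAt.inv₀ (by fun_prop) (hw j))
  exact h.tendsto.smul tendsto_const_nhds

theorem eventually_one_sub_mul_ne_zero {n : ℕ} (t : Fin n → ℂ) :
    ∀ᶠ z : ℂ in 𝓝 0, ∀ j, 1 - t j * z ≠ 0 := by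
  rw [Filter.eventually_all]
  intro j
  have hc : Continuous fun z : ℂ => 1 - t j * z := by fun_prop
  exact (hc.tendsto 0).eventually (isOpen_ne.mem_nhds (by simp))

/-- Only the behaviour over `∞` needs an argument, since there just holomorphy is assumed. The
equation is carried over from nearby finite points to a punctured disc in the coordinate `1/x`, then
extended to its centre by continuity. -/
theorem IsNormalizedSolution.isSolution {n k : ℕ} {t : Fin n → ℂ}
    {Q : Fin n → Matrix (Fin k) (Fin k) ℂ} (hsum : ∑ j, Q j = 0)
    {Y : Cov (puncturedInfty t) → Matrix (Fin k) (Fin k) ℂ} (hY : IsNormalizedSolution t Q Y) :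
    IsSolution t Q Y := by
  intro P
  by_cases hP : (P.1 : CP1) = ∞
  swap
  · obtain ⟨g, hg, hd⟩ := hY.ode P hP
    exact ⟨_, g, _, rfl, rfl, by simpa only [if_neg hP] using hg, by
      simpa only [if_neg hP] using hd⟩
  obtain ⟨g, hg, hd⟩ := hY.holomorphic_infty P hP
  refine ⟨_, g, _, rfl, rfl, by simpa only [if_pos hP] using hg, ?_⟩
  simp only [if_pos hP]
  obtain ⟨N, hN, hNg⟩ := hg
  obtain ⟨⟨x, hx⟩, α⟩ := P
  change x = ∞ at hP
  subst hP
  change ∀ᶠ w in 𝓝 0, DifferentiableAt ℂ g w at hd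
  change ∀ᶠ w in 𝓝 0, _
  obtain ⟨R, hR, hRN⟩ := exists_radius_of_mem_nhds_infty hx hN
  set R' := R + ∑ j, ‖t j‖ with hR'
  have hs0 : 0 ≤ ∑ j, ‖t j‖ := Finset.sum_nonneg fun _ _ => norm_nonneg _
  have hmemS : ∀ z : ℂ, R' < ‖z‖ → (z : CP1) ∈ puncturedSphere t := fun z hz =>
    puncturedSphere_of_lt_norm t (by linarith)
  set B : ℂ → Matrix (Fin k) (Fin k) ℂ := fun w => -∑ j, (t j * (1 - t j * w)⁻¹) • Q j with hB
  have hne := eventually_one_sub_mul_ne_zero t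
  have hpunct : ∀ᶠ z in 𝓝[≠] (0 : ℂ), HasDerivAt g (B z * g z) z := by
    have hinv : ∀ᶠ z in 𝓝[≠] (0 : ℂ), R' < ‖z⁻¹‖ := by
      have := (tendsto_norm_cobounded_atTop (E := ℂ)).comp (Filter.tendsto_inv₀_nhdsNE_zero (α := ℂ))
      exact this.eventually_gt_atTop R'
    filter_upwards [hinv, self_mem_nhdsWithin, nhdsWithin_le_nhds hne] with z hz hz0 hz1
    have hz0 : z ≠ 0 := hz0
    set w := z⁻¹ with hw
    obtain ⟨β, hβ⟩ := exists_path_infty hx (R := R') (by linarith) hmemS hz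
    have hβN : ∀ s, β s ∈ N := fun s => hRN _ ((hβ s).imp_right fun ⟨z, hz, h⟩ =>
      ⟨z, by linarith, h⟩)
    obtain ⟨g₂, ⟨N₂, hN₂, hg₂⟩, hd₂⟩ := hY.ode (Cov.mk _ (α.trans (Path.Homotopic.Quotient.mk β)))
      (OnePoint.coe_ne_infty w)
    have hopen : {v : ℂ | R' < ‖v‖} ∈ 𝓝 w := (isOpen_lt continuous_const continuous_norm).mem_nhds hz
    have hcoe : ∀ᶠ v : ℂ in 𝓝 w, ∀ hv : R' < ‖v‖, (⟨v, hmemS v hv⟩ : puncturedSphere t) ∈ N₂ := by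
      obtain ⟨M, hM, hMN⟩ := mem_nhds_subtype _ _ _ |>.1 hN₂
      have := OnePoint.continuous_coe.continuousAt (x := w) hM
      filter_upwards [this] with v hv hv' using hMN hv
    obtain ⟨ρ, hρ, hball⟩ := Metric.mem_nhds_iff.1 (Filter.inter_mem hopen hcoe)
    -- Near `w`, both `g (v⁻¹)` and `g₂ v` are the value of `Y` at the same point of the covering,
    -- reached from `∞` through `w`.
    have heq : (fun v => g v⁻¹) =ᶠ[𝓝 w] g₂ := by
      filter_upwards [Metric.ball_mem_nhds w hρ] with v hv
      obtain ⟨β', hβ'⟩ := exists_path_coe ((convex_ball w ρ).isPathConnected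
        ⟨w, Metric.mem_ball_self hρ⟩) (fun v hv => hmemS v (hball hv).1)
        (Metric.mem_ball_self hρ) hv
      have h1 := hg₂ _ β' (fun s => by
        obtain ⟨u, hu, hus⟩ := hβ' s
        have := (hball hu).2 (hball hu).1
        rwa [show (⟨u, hmemS u (hball hu).1⟩ : puncturedSphere t) = β' s from
          Subtype.ext hus.symm] at this)
      have h2 := hNg _ (β.trans β') (fun s => by
        have hs : (β.trans β') s ∈ Set.range (β.trans β') := ⟨s, rfl⟩
        rw [Path.trans_range] at hs
        rcases hs with ⟨u, hu⟩ | ⟨u, hu⟩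
        · rw [← hu]; exact hβN u
        · rw [← hu]
          obtain ⟨v, hv, hvs⟩ := hβ' u
          exact hRN _ (Or.inr ⟨v, by have : R' < ‖v‖ := (hball hv).1
                                     linarith, hvs⟩))
      rw [Path.Homotopic.Quotient.mk_trans, ← Path.Homotopic.Quotient.trans_assoc] at h2
      exact h2.symm.trans h1
    have hd3 : HasDerivAt (fun v => g v⁻¹) (coefficient t Q w * g z) w := by
      have h1 := hd₂.self_of_nhds.congr_of_eventuallyEq heq
      have h2 : g₂ w = g z := by
        rw [← heq.self_of_nhds]
        change g z⁻¹⁻¹ = g z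
        rw [inv_inv]
      change HasDerivAt (fun v => g v⁻¹) (coefficient t Q w * g₂ w) w at h1
      rwa [h2] at h1
    have hd4 := HasDerivAt.scomp z hd3 (hasDerivAt_inv hz0)
    have h5 : ((fun v => g v⁻¹) ∘ fun y : ℂ => y⁻¹) = g := by
      funext v
      simp
    rw [show (Inv.inv : ℂ → ℂ) = fun y => y⁻¹ from rfl, h5, ← smul_mul_assoc, coefficient_inv_eq hsum hz0 hz1] at hd4
    exact hd4
  have h0 := hasDerivAt_of_punctured (continuousAt_coefficient_infty Q hne.self_of_nhds) hd hpunct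
  rw [eventually_nhdsWithin_iff] at hpunct
  filter_upwards [hpunct] with z hz
  by_cases hz0 : z = 0
  · rw [hz0]; exact h0
  · exact hz hz0

/-- In a coordinate disc this is uniqueness for a linear equation with continuous coefficient, used
in both directions. -/
theorem IsSolution.locally_zero_iff {n k : ℕ} {t : Fin n → ℂ}
    {Q : Fin n → Matrix (Fin k) (Fin k) ℂ}
    {F : Cov (puncturedInfty t) → Matrix (Fin k) (Fin k) ℂ} (hF : IsSolution t Q F)
    (P : Cov (puncturedInfty t)) :
    ∃ N ∈ 𝓝 P.1, ∀ (y : puncturedSphere t) (β : Path P.1 y), (∀ s, β s ∈ N) →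
      (F (Cov.mk y (P.2.trans (Path.Homotopic.Quotient.mk β))) = 0 ↔ F P = 0) := by
  obtain ⟨z, g, B, hz, hB, ⟨N, hN, hg⟩, hd⟩ := hF P
  have hzc : ContinuousAt z P.1 := by
    by_cases hP : (P.1 : CP1) = ∞
    · rw [hz, if_pos hP]
      exact ContinuousAt.comp (g := inftyCoord) (by rw [hP]; exact continuousAt_inftyCoord)
        continuous_subtype_val.continuousAt
    · rw [hz, if_neg hP]
      exact ContinuousAt.comp (g := affineCoord) (continuousAt_affineCoord hP)
        continuous_subtype_val.continuousAt
  have hBc : ∀ᶠ w in 𝓝 (z P.1), ContinuousAt B w := by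
    by_cases hP : (P.1 : CP1) = ∞
    · have h0 : z P.1 = 0 := by
        rw [hz, if_pos hP]
        exact congrArg inftyCoord hP
      rw [h0, hB, if_pos hP]
      exact (eventually_one_sub_mul_ne_zero t).mono fun w hw => continuousAt_coefficient_infty Q hw
    · have h0 : z P.1 = affineCoord (P.1 : CP1) := by rw [hz, if_neg hP]
      rw [h0, hB, if_neg hP]
      have hne : ∀ᶠ w : ℂ in 𝓝 (affineCoord P.1), ∀ j, w - t j ≠ 0 := by
        rw [Filter.eventually_all]
        intro j
        have hc : Continuous fun z : ℂ => z - t j := by fun_prop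
        refine (hc.tendsto _).eventually (isOpen_ne.mem_nhds ?_)
        intro h0
        refine P.1.2 j ?_
        rw [eq_coe_affineCoord hP, sub_eq_zero.1 h0]
      exact hne.mono fun w hw => continuousAt_coefficient Q hw
  obtain ⟨ρ, hρ, hball⟩ := Metric.mem_nhds_iff.1 (Filter.inter_mem hBc hd)
  refine ⟨N ∩ z ⁻¹' Metric.ball (z P.1) ρ,
    Filter.inter_mem hN (hzc (Metric.ball_mem_nhds _ hρ)), fun y β hβ => ?_⟩
  have h1 := hg y β fun s => (hβ s).1
  have h2 := hg P.1 (Path.refl P.1) fun s => mem_of_mem_nhds hN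
  rw [Cov.mk_trans_refl] at h2
  rw [h1, h2]
  have hy : z y ∈ Metric.ball (z P.1) ρ := by
    have := (hβ 1).2
    rwa [β.target] at this
  have hc : ContinuousOn B (Metric.ball (z P.1) ρ) := fun w hw =>
    (hball hw).1.continuousWithinAt
  have hp := Metric.mem_ball_self (x := z P.1) hρ
  exact ⟨eq_zero_of_hasDerivAt_mul hc (fun w hw => (hball hw).2) hy hp,
    eq_zero_of_hasDerivAt_mul hc (fun w hw => (hball hw).2) hp hy⟩

/-- A solution that vanishes at one point of the universal covering surface vanishes identically. -/
theorem IsSolution.eq_zero_iff {n k : ℕ} {t : Fin n → ℂ}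
    {Q : Fin n → Matrix (Fin k) (Fin k) ℂ}
    {F : Cov (puncturedInfty t) → Matrix (Fin k) (Fin k) ℂ} (hF : IsSolution t Q F)
    (P : Cov (puncturedInfty t)) :
    F P = 0 ↔ F (Cov.mk _ (Path.Homotopic.Quotient.refl _)) = 0 :=
  Cov.iff_of_locally_iff (p := fun P => F P = 0) hF.locally_zero_iff P

theorem IsSolution.mul_const {n k : ℕ} {t : Fin n → ℂ}
    {Q : Fin n → Matrix (Fin k) (Fin k) ℂ}
    {F : Cov (puncturedInfty t) → Matrix (Fin k) (Fin k) ℂ} (hF : IsSolution t Q F)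
    (C : Matrix (Fin k) (Fin k) ℂ) : IsSolution t Q fun P => F P * C := by
  intro P
  obtain ⟨z, g, B, hz, hB, ⟨N, hN, hg⟩, hd⟩ := hF P
  refine ⟨z, fun w => g w * C, B, hz, hB, ⟨N, hN, fun y β hβ => ?_⟩, ?_⟩
  · dsimp only
    rw [hg y β hβ]
  · filter_upwards [hd] with w hw
    have := hw.mul_const C
    rwa [mul_assoc] at this

theorem IsSolution.sub {n k : ℕ} {t : Fin n → ℂ}
    {Q : Fin n → Matrix (Fin k) (Fin k) ℂ}
    {F G : Cov (puncturedInfty t) → Matrix (Fin k) (Fin k) ℂ} (hF : IsSolution t Q F)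
    (hG : IsSolution t Q G) : IsSolution t Q fun P => F P - G P := by
  intro P
  obtain ⟨z, g, B, hz, hB, ⟨N, hN, hg⟩, hd⟩ := hF P
  obtain ⟨z', g', B', hz', hB', ⟨N', hN', hg'⟩, hd'⟩ := hG P
  obtain rfl : z' = z := hz'.trans hz.symm
  obtain rfl : B' = B := hB'.trans hB.symm
  refine ⟨z', fun w => g w - g' w, B', hz, hB, ⟨N ∩ N', Filter.inter_mem hN hN',
    fun y β hβ => ?_⟩, ?_⟩
  · dsimp only
    rw [hg y β fun s => (hβ s).1, hg' y β fun s => (hβ s).2]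
  · filter_upwards [hd, hd'] with w hw hw'
    have := hw.sub hw'
    rwa [← mul_sub] at this

end Norm

theorem IsSolution.precomp {n k : ℕ} {t : Fin n → ℂ}
    {Q : Fin n → Matrix (Fin k) (Fin k) ℂ}
    {F : Cov (puncturedInfty t) → Matrix (Fin k) (Fin k) ℂ} (hF : IsSolution t Q F)
    (γ : Path.Homotopic.Quotient (puncturedInfty t) (puncturedInfty t)) :
    IsSolution t Q fun P => F (Cov.precomp γ P) := by
  intro P
  obtain ⟨z, g, B, hz, hB, ⟨N, hN, hg⟩, hd⟩ := hF (Cov.precomp γ P)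
  refine ⟨z, g, B, hz, hB, ⟨N, hN, fun y β hβ => ?_⟩, hd⟩
  rw [← hg y β hβ]
  simp only [Cov.precomp, Cov.mk]
  rw [Path.Homotopic.Quotient.trans_assoc]

/-- The value of the normalized solution at `(∞, γ)` is the monodromy matrix of the loop `γ`. -/
theorem IsNormalizedSolution.isMonodromyMatrix {n k : ℕ} {t : Fin n → ℂ}
    {Q : Fin n → Matrix (Fin k) (Fin k) ℂ} (hsum : ∑ j, Q j = 0)
    {Y : Cov (puncturedInfty t) → Matrix (Fin k) (Fin k) ℂ} (hY : IsNormalizedSolution t Q Y)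
    (γ : Path.Homotopic.Quotient (puncturedInfty t) (puncturedInfty t)) :
    IsMonodromyMatrix Y γ (Y (Cov.mk _ γ)) := by
  intro P
  have hs := hY.isSolution hsum
  -- Both sides of the monodromy relation are solutions, and by the normalization they agree over
  -- the distinguished point.
  have := ((hs.precomp γ).sub (hs.mul_const (Y (Cov.mk _ γ)))).eq_zero_iff P
  rw [← sub_eq_zero, this, hY.normalized, one_mul, sub_eq_zero]
  simp only [Cov.precomp, Cov.mk]
  rw [Path.Homotopic.Quotient.trans_refl]

/-- If `v` were a kernel vector at `P`, multiplying `Y` by the matrix with all columns `v` would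
give a solution vanishing at `P`, hence everywhere; at the distinguished point it equals that
matrix, so `v = 0`. -/
theorem IsNormalizedSolution.isUnit {n k : ℕ} {t : Fin n → ℂ}
    {Q : Fin n → Matrix (Fin k) (Fin k) ℂ} (hsum : ∑ j, Q j = 0)
    {Y : Cov (puncturedInfty t) → Matrix (Fin k) (Fin k) ℂ} (hY : IsNormalizedSolution t Q Y)
    (P : Cov (puncturedInfty t)) : IsUnit (Y P) := by
  have hs := hY.isSolution hsum
  rw [Matrix.isUnit_iff_isUnit_det, isUnit_iff_ne_zero]
  intro hdet
  obtain ⟨v, hv0, hv⟩ := Matrix.exists_mulVec_eq_zero_iff.2 hdet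
  have hk : 0 < k := by
    rcases Nat.eq_zero_or_pos k with rfl | hk
    · exact absurd (Subsingleton.elim v 0) hv0
    · exact hk
  have h1 : Y P * Matrix.of (fun (i _ : Fin k) => v i) = 0 := by
    ext i j
    exact congrFun hv i
  have h2 := ((hs.mul_const _).eq_zero_iff P).1 h1
  rw [hY.normalized, one_mul] at h2
  refine hv0 (funext fun i => ?_)
  exact congrFun (congrFun h2 i) ⟨0, hk⟩

/-! ## Functions with a right monodromy action -/

/-- An invertible matrix function on the universal covering space that is multiplied from the right
by a constant matrix under each deck transformation. -/
structure HasMonodromy {X : Type*} [TopologicalSpace X] {x₀ : X} {k : ℕ}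
    (Z : Cov x₀ → Matrix (Fin k) (Fin k) ℂ) : Prop where
  precomp : ∀ (g : Path.Homotopic.Quotient x₀ x₀) (P : Cov x₀),
    Z (Cov.precomp g P) = Z P * Z (Cov.mk x₀ g)
  isUnit : ∀ P, IsUnit (Z P)

namespace HasMonodromy

variable {X : Type*} [TopologicalSpace X] {x₀ : X} {k : ℕ}
  {Z Z' : Cov x₀ → Matrix (Fin k) (Fin k) ℂ}

theorem isUnit_det (hZ : HasMonodromy Z) (P : Cov x₀) : IsUnit (Z P).det :=
  (Matrix.isUnit_iff_isUnit_det _).1 (hZ.isUnit P)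

/-- The branches along `α` and `α'` differ by a right factor that is the same at the end of every
continuation `β`; this drives all later cancellations. -/
theorem trans_eq_mul (hZ : HasMonodromy Z) {x y : X} (α : Path.Homotopic.Quotient x₀ x)
    (α' : Path.Homotopic.Quotient x₀ x) (β : Path.Homotopic.Quotient x y) :
    Z (Cov.mk y (α.trans β)) =
      Z (Cov.mk y (α'.trans β)) * Z (Cov.mk x₀ (α.trans α'.symm)) := by
  have h := hZ.precomp (α.trans α'.symm) (Cov.mk y (α'.trans β))
  rw [← h]
  simp only [Cov.precomp, Cov.mk]
  rw [← Path.Homotopic.Quotient.trans_assoc, Path.Homotopic.Quotient.trans_assoc α,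
    Path.Homotopic.Quotient.symm_trans, Path.Homotopic.Quotient.trans_refl]

theorem eq_mul (hZ : HasMonodromy Z) {x : X} (α α' : Path.Homotopic.Quotient x₀ x) :
    Z (Cov.mk x α) = Z (Cov.mk x α') * Z (Cov.mk x₀ (α.trans α'.symm)) := by
  have h := hZ.trans_eq_mul α α' (Path.Homotopic.Quotient.refl x)
  rwa [Path.Homotopic.Quotient.trans_refl, Path.Homotopic.Quotient.trans_refl] at h

/-- The local monodromy matrix corresponding to the branch `α` and the loop `δ` can be calculated at
an arbitrary point. -/
theorem inv_mul_trans (hZ : HasMonodromy Z) {x y : X} (α : Path.Homotopic.Quotient x₀ x)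
    (δ : Path.Homotopic.Quotient x x) (β : Path.Homotopic.Quotient x y) :
    (Z (Cov.mk y (α.trans β)))⁻¹ * Z (Cov.mk y (α.trans (δ.trans β))) =
      (Z (Cov.mk x α))⁻¹ * Z (Cov.mk x (α.trans δ)) := by
  rw [← Path.Homotopic.Quotient.trans_assoc, hZ.trans_eq_mul (α.trans δ) α β,
    hZ.eq_mul (α.trans δ) α, Matrix.nonsing_inv_mul_cancel_left _ _ (hZ.isUnit_det _),
    Matrix.nonsing_inv_mul_cancel_left _ _ (hZ.isUnit_det _)]

/-- Coincidence of two values of the ratio `Z Z'⁻¹` propagates along paths. -/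
theorem ratio_eq_iff (hZ : HasMonodromy Z) (hZ' : HasMonodromy Z') {x y : X}
    (α α' : Path.Homotopic.Quotient x₀ x) (β : Path.Homotopic.Quotient x y) :
    Z (Cov.mk y (α.trans β)) * (Z' (Cov.mk y (α.trans β)))⁻¹ =
        Z (Cov.mk y (α'.trans β)) * (Z' (Cov.mk y (α'.trans β)))⁻¹ ↔
      Z (Cov.mk x α) * (Z' (Cov.mk x α))⁻¹ = Z (Cov.mk x α') * (Z' (Cov.mk x α'))⁻¹ := by
  -- With `A` and `B` the right factors of `Z` and `Z'`, equality of the two ratios amounts to `A *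
  -- B⁻¹ = 1`, a condition free of the point `P`.
  have key : ∀ {y : X} (A B : Matrix (Fin k) (Fin k) ℂ) (P : Cov x₀), IsUnit B →
      (Z P * A * (Z' P * B)⁻¹ = Z P * (Z' P)⁻¹ ↔ A * B⁻¹ = 1) := by
    intro y A B P hB
    rw [Matrix.mul_inv_rev, mul_assoc, ← mul_assoc A, (hZ.isUnit P).mul_right_inj]
    have hu : IsUnit (Z' P)⁻¹ := Matrix.isUnit_nonsing_inv_iff.2 (hZ'.isUnit P)
    conv_lhs => rw [← one_mul (Z' P)⁻¹, ← mul_assoc, mul_one]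
    rw [hu.mul_left_inj]
  rw [hZ.trans_eq_mul α α' β, hZ'.trans_eq_mul α α' β, hZ.eq_mul α α', hZ'.eq_mul α α',
    key (y := y) _ _ _ (hZ'.isUnit _), key (y := x) _ _ _ (hZ'.isUnit _)]

end HasMonodromy

/-! ## The Riemann surface of the logarithm -/

/-- Two continuous logarithms with common ends are joined by linear interpolation in the logarithmic
plane, and its exponential is a homotopy avoiding zero. A point of the surface is thus determined by
the final value of a logarithm started at a fixed value. -/
theorem logSurface_mk_eq {ζ₁ ζ₂ : PuncturedPlane 0}
    (b₁ : Path (⟨1, one_ne_zero⟩ : PuncturedPlane 0) ζ₁)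
    (b₂ : Path (⟨1, one_ne_zero⟩ : PuncturedPlane 0) ζ₂) (σ₁ σ₂ : C(unitInterval, ℂ))
    (h₁ : ∀ s, Complex.exp (σ₁ s) = b₁ s) (h₂ : ∀ s, Complex.exp (σ₂ s) = b₂ s)
    (h0 : σ₁ 0 = σ₂ 0) (h1 : σ₁ 1 = σ₂ 1) :
    (Cov.mk ζ₁ (Path.Homotopic.Quotient.mk b₁) : LogSurface) =
      Cov.mk ζ₂ (Path.Homotopic.Quotient.mk b₂) := by
  have hζ : ζ₁ = ζ₂ := by
    refine Subtype.ext ?_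
    have e1 := h₁ 1
    have e2 := h₂ 1
    rw [b₁.target] at e1
    rw [b₂.target] at e2
    rw [← e1, ← e2, h1]
  subst hζ
  refine congrArg (Cov.mk ζ₁) (Path.Homotopic.Quotient.eq.2 ⟨?_⟩)
  exact
    { toFun := fun x => ⟨Complex.exp ((1 - ((x.1 : ℝ) : ℂ)) * σ₁ x.2 + ((x.1 : ℝ) : ℂ) * σ₂ x.2),
        Complex.exp_ne_zero _⟩
      continuous_toFun := by
        refine Continuous.subtype_mk ?_ _
        fun_prop
      map_zero_left := fun s => Subtype.ext (by simpa using h₁ s)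
      map_one_left := fun s => Subtype.ext (by simpa using h₂ s)
      prop' := by
        rintro s x (rfl | rfl)
        · refine Subtype.ext ?_
          change Complex.exp ((1 - ((s : ℝ) : ℂ)) * σ₁ 0 + ((s : ℝ) : ℂ) * σ₂ 0) = b₁ 0
          rw [← h0, ← h₁ 0]
          ring_nf
        · refine Subtype.ext ?_
          change Complex.exp ((1 - ((s : ℝ) : ℂ)) * σ₁ 1 + ((s : ℝ) : ℂ) * σ₂ 1) = b₁ 1
          rw [← h1, ← h₁ 1]
          ring_nf }

/-- The point of the Riemann surface of `ln ζ` at which `ln ζ = u`. -/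
noncomputable def logPoint (u : ℂ) : LogSurface :=
  Cov.mk ⟨Complex.exp u, Complex.exp_ne_zero u⟩ (Path.Homotopic.Quotient.mk
    { toFun := fun s => ⟨Complex.exp (u * ((s : ℝ) : ℂ)), Complex.exp_ne_zero _⟩
      continuous_toFun := by
        refine Continuous.subtype_mk ?_ _
        fun_prop
      source' := Subtype.ext (by simp)
      target' := Subtype.ext (by simp) })

theorem logSurface_mk_eq_logPoint {ζ : PuncturedPlane 0}
    (b : Path (⟨1, one_ne_zero⟩ : PuncturedPlane 0) ζ) (σ : C(unitInterval, ℂ))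
    (h : ∀ s, Complex.exp (σ s) = b s) (h0 : σ 0 = 0) :
    (Cov.mk ζ (Path.Homotopic.Quotient.mk b) : LogSurface) = logPoint (σ 1) :=
  logSurface_mk_eq b _ σ ⟨fun s => σ 1 * ((s : ℝ) : ℂ), by fun_prop⟩ h (fun _ => rfl)
    (by simp [h0]) (by simp)

/-- Concatenation of logarithms along a concatenation of paths. -/
theorem exists_log_trans {X : Type*} [TopologicalSpace X] {x y z : X} (a : Path x y) (b : Path y z)
    (f : X → ℂ) (σ ρ : C(unitInterval, ℂ)) (hσ : ∀ s, Complex.exp (σ s) = f (a s))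
    (hρ : ∀ s, Complex.exp (ρ s) = f (b s)) (h : σ 1 = ρ 0) :
    ∃ τ : C(unitInterval, ℂ), (∀ s, Complex.exp (τ s) = f (a.trans b s)) ∧ τ 0 = σ 0 ∧
      τ 1 = ρ 1 := by
  let p : Path (σ 0) (σ 1) := ⟨σ, rfl, rfl⟩
  let q : Path (σ 1) (ρ 1) := ⟨ρ, h.symm, rfl⟩
  refine ⟨p.trans q, fun s => ?_, (p.trans q).source, (p.trans q).target⟩
  change Complex.exp (p.trans q s) = _
  rw [Path.trans_apply, Path.trans_apply]
  split_ifs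
  · exact hσ _
  · exact hρ _

theorem precomp_argPath_eq_logPoint {ζ ξ : PuncturedPlane 0} {θ : ℝ} (hθ : IsArgValue ζ θ)
    (b : Path ζ ξ) (σ : C(unitInterval, ℂ)) (h : ∀ s, Complex.exp (σ s) = b s)
    (h0 : σ 0 = Real.log ‖(ζ : ℂ)‖ + θ * Complex.I) :
    Cov.precomp (Path.Homotopic.Quotient.mk (argPath ζ θ hθ))
      (Cov.mk ξ (Path.Homotopic.Quotient.mk b)) = logPoint (σ 1) := by
  obtain ⟨τ, hτ, hτ0, hτ1⟩ := exists_log_trans (argPath ζ θ hθ) b (fun z => (z : ℂ))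
    ⟨fun s => (Real.log ‖(ζ : ℂ)‖ + θ * Complex.I) * ((s : ℝ) : ℂ), by fun_prop⟩ σ
    (fun _ => rfl) h (by simp [h0])
  rw [← hτ1]
  exact logSurface_mk_eq_logPoint _ τ hτ (by simp [hτ0])

/-- Existence of a continuous logarithm along a path that avoids zero. -/
theorem exists_log_along (f : C(unitInterval, ℂ)) (hf : ∀ s, f s ≠ 0) (u : ℂ)
    (hu : Complex.exp u = f 0) :
    ∃ σ : C(unitInterval, ℂ), σ 0 = u ∧ ∀ s, Complex.exp (σ s) = f s := by
  let f' : C(unitInterval, {z : ℂ // z ≠ 0}) := ⟨fun s => ⟨f s, hf s⟩, f.continuous.subtype_mk _⟩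
  obtain ⟨σ, hσ, hσ0⟩ := Complex.isCoveringMap_exp.exists_path_lifts f' u (Subtype.ext hu.symm)
  exact ⟨σ, hσ0, fun s => congrArg Subtype.val (congrFun hσ s)⟩

/-! ## Nested pairs of cylindrical neighbourhoods -/

namespace IsNestedPair

variable {n : ℕ} {D : Set (Fin n → ℂ)} {t₀ : Fin n → ℂ} {W V : Fin n → Set ℂ}

/-- Places a one-dimensional closure inside the closure of the cylinder, so that the compact
inclusions of cylinders pass to each factor. -/
theorem update_mem_closure (h : IsNestedPair D t₀ W V) {j : Fin n} {w : ℂ}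
    (hw : w ∈ closure (W j)) : Function.update t₀ j w ∈ closure (cylinder W) := by
  have h1 : Set.MapsTo (fun w => Function.update t₀ j w) (W j) (cylinder W) := by
    intro w hw l
    by_cases hl : l = j
    · subst hl
      simpa using hw
    · simpa [Function.update_of_ne hl] using h.nhd_inner.mem l
  exact h1.closure (continuous_const.update j continuous_id) hw

theorem closure_subset (h : IsNestedPair D t₀ W V) (j : Fin n) : closure (W j) ⊆ V j := by
  intro w hw
  have := (h.inner.subset (h.update_mem_closure hw)).1 j
  rwa [Function.update_self] at this

theorem isCompact_closure (h : IsNestedPair D t₀ W V) (j : Fin n) : IsCompact (closure (W j)) := by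
  refine (h.inner.isCompact.image (continuous_apply j)).of_isClosed_subset isClosed_closure ?_
  intro w hw
  exact ⟨_, h.update_mem_closure hw, Function.update_self _ _ _⟩

/-- A common point could be taken as both the `i`-th and the `j`-th coordinate of a point of the
outer cylinder, whose points have distinct coordinates. -/
theorem disjoint_outer (h : IsNestedPair D t₀ W V) {i j : Fin n} (hij : i ≠ j) {z : ℂ}
    (hi : z ∈ V i) (hj : z ∈ V j) : False := by
  have hu : Function.update (Function.update t₀ i z) j z ∈ cylinder V := by
    intro l
    by_cases hlj : l = j
    · subst hlj
      simpa using hj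
    · rw [Function.update_of_ne hlj]
      by_cases hli : l = i
      · subst hli
        simpa using hi
      · simpa [Function.update_of_ne hli] using h.nhd_outer.mem l
  have := h.outer.subset (subset_closure hu) i j hij
  rw [Function.update_self, Function.update_of_ne hij, Function.update_self] at this
  exact this rfl

theorem coe_mem_perforated_iff {z : ℂ} :
    (z : CP1) ∈ perforatedSphere W ↔ ∀ j, z ∉ closure (W j) :=
  ⟨fun h j hz => h j z hz rfl, fun h j w hw hzw => h j (by rwa [OnePoint.coe_injective hzw])⟩

theorem coe_mem_perforated (h : IsNestedPair D t₀ W V) (j : Fin n) :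
    ∀ z ∈ V j \ closure (W j), (z : CP1) ∈ perforatedSphere W := by
  intro z hz
  rw [coe_mem_perforated_iff]
  intro i hi
  by_cases hij : i = j
  · subst hij
    exact hz.2 hi
  · exact h.disjoint_outer hij (h.closure_subset i hi) hz.1

theorem isOpen_diff (h : IsNestedPair D t₀ W V) (j : Fin n) : IsOpen (V j \ closure (W j)) :=
  (h.nhd_outer.isOpen j).sdiff isClosed_closure

/-- Unicoherence for the cover of the plane by `V j` and the complement of `closure (W j)`.
Nonemptiness holds because otherwise `V j` would be clopen, hence the whole plane, yet compact. -/
theorem isPathConnected_diff (h : IsNestedPair D t₀ W V) (j : Fin n) :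
    IsPathConnected (V j \ closure (W j)) := by
  rw [← (h.isOpen_diff j).isConnected_iff_isPathConnected]
  constructor
  · rw [Set.sdiff_nonempty]
    intro hsub
    have hV : V j = closure (W j) := hsub.antisymm (h.closure_subset j)
    have hclopen : IsClopen (V j) := ⟨hV ▸ isClosed_closure, h.nhd_outer.isOpen j⟩
    have huniv := hclopen.eq_univ ⟨_, h.nhd_outer.mem j⟩
    have hc := h.isCompact_closure j
    rw [← hV, huniv] at hc
    exact noncompact_univ ℂ hc
  · refine isPreconnected_inter_of_union_eq_univ (h.nhd_outer.isOpen j)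
      isClosed_closure.isOpen_compl
      (h.nhd_outer.simplyConnected j).isPathConnected.isConnected.isPreconnected
      (h.nhd_inner.connected_compl j).isPreconnected ?_
    rw [Set.eq_univ_iff_forall]
    intro z
    by_cases hz : z ∈ closure (W j)
    · exact Or.inl (h.closure_subset j hz)
    · exact Or.inr hz

end IsNestedPair

/-! ## Solutions on the universal covering of the perforated sphere -/

/-- The inclusion of the perforated sphere into the punctured sphere. -/
noncomputable def perforatedInclusion {n : ℕ} {W : Fin n → Set ℂ} {t : Fin n → ℂ} (ht : t ∈ cylinder W) :
    C(perforatedSphere W, puncturedSphere t) :=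
  ⟨Set.inclusion (perforated_subset_punctured ht),
    continuous_inclusion (perforated_subset_punctured ht)⟩

/-- The solution as a function on the universal covering space of the perforated sphere. -/
noncomputable def perforatedSolution {n k : ℕ} (Y : ∀ t : Fin n → ℂ, Cov (puncturedInfty t) →
    Matrix (Fin k) (Fin k) ℂ) {W : Fin n → Set ℂ} {t : Fin n → ℂ} (ht : t ∈ cylinder W)
    (P : Cov (perforatedInfty W)) : Matrix (Fin k) (Fin k) ℂ :=
  Y t (Cov.map (perforatedInclusion ht) P)

theorem quotient_map_trans {X Y : Type*} [TopologicalSpace X] [TopologicalSpace Y] {x y z : X}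
    (α : Path.Homotopic.Quotient x y) (β : Path.Homotopic.Quotient y z) (f : C(X, Y)) :
    (α.trans β).map f = (α.map f).trans (β.map f) := by
  induction α using Path.Homotopic.Quotient.ind with | mk a =>
  induction β using Path.Homotopic.Quotient.ind with | mk b =>
  rw [← Path.Homotopic.Quotient.mk_trans, ← Path.Homotopic.Quotient.mk_map,
    ← Path.Homotopic.Quotient.mk_map, ← Path.Homotopic.Quotient.mk_map,
    ← Path.Homotopic.Quotient.mk_trans, Path.map_trans]

theorem hasMonodromy_perforatedSolution {n k : ℕ}
    {Y : ∀ t : Fin n → ℂ, Cov (puncturedInfty t) → Matrix (Fin k) (Fin k) ℂ}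
    {W : Fin n → Set ℂ} {t : Fin n → ℂ} (ht : t ∈ cylinder W)
    {Q : Fin n → Matrix (Fin k) (Fin k) ℂ} (hsum : ∑ j, Q j = 0)
    (hY : IsNormalizedSolution t Q (Y t)) : HasMonodromy (perforatedSolution Y ht) where
  precomp g P := by
    have h := hY.isMonodromyMatrix hsum (g.map (perforatedInclusion ht))
      (Cov.map (perforatedInclusion ht) P)
    have h2 : Cov.map (perforatedInclusion ht) (Cov.precomp g P) =
        Cov.precomp (g.map (perforatedInclusion ht)) (Cov.map (perforatedInclusion ht) P) := by
      simp only [Cov.map, Cov.precomp, Cov.mk]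
      rw [quotient_map_trans]
    rw [perforatedSolution, h2]
    exact h
  isUnit P := hY.isUnit hsum _

/-- The condition in the definition of isoprincipal families on a nested pair of cylindrical
neighbourhoods. -/
def IsoprincipalOn {n k : ℕ} {D : Set (Fin n → ℂ)}
    (Y : ∀ t : Fin n → ℂ, Cov (puncturedInfty t) → Matrix (Fin k) (Fin k) ℂ) {t₀ : Fin n → ℂ}
    {W V : Fin n → Set ℂ} (hWV : IsNestedPair D t₀ W V) : Prop :=
  ∀ (j : Fin n) (p : ℂ) (hp : p ∈ V j \ closure (W j)) (hp' : (p : CP1) ∈ perforatedSphere W)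
    (α : Path (perforatedInfty W) ⟨(p : CP1), hp'⟩),
    ∃ E : LogSurface → Matrix (Fin k) (Fin k) ℂ, IsHolomorphicInvertible E ∧
    ∃ θ : ℂ → ℝ, ContinuousOn θ (W j) ∧
    ∃ hθ : ∀ τ ∈ W j, IsArgValue (p - τ) (θ τ),
    ∀ (t : Fin n → ℂ) (ht : t ∈ cylinder W),
    ∃ H : ℂ → Matrix (Fin k) (Fin k) ℂ,
      DifferentiableOn ℂ H (V j) ∧ (∀ x ∈ V j, IsUnit (H x)) ∧
      ∀ P : Cov (⟨p, mem_diff_singleton ht hp⟩ : (V j \ {t j} : Set ℂ)),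
        branch (Y t) (hWV.diff_subset_punctured ht j) _ (toPunctured ht α) P =
          H (P.1 : ℂ) * transplant E (diffInclusion (V j) (t j)
            ⟨p, mem_diff_singleton ht hp⟩) (θ (t j)) (hθ (t j) (ht j))
            (Cov.map (diffInclusion (V j) (t j)) P)

/-- In terms of the logarithmic coordinate, each branch of the solution in `Vⱼ ∖ closure Wⱼ` is the
product of a single-valued factor and a function of `ln (x - tⱼ)` independent of `t`. -/
theorem IsoprincipalOn.exists_log_factor {n k : ℕ} {D : Set (Fin n → ℂ)}
    {Y : ∀ t : Fin n → ℂ, Cov (puncturedInfty t) → Matrix (Fin k) (Fin k) ℂ} {t₀ : Fin n → ℂ}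
    {W V : Fin n → Set ℂ} {hWV : IsNestedPair D t₀ W V} (h : IsoprincipalOn Y hWV) (j : Fin n)
    (p : ℂ) (hp : p ∈ V j \ closure (W j))
    (α : Path (perforatedInfty W) ⟨(p : CP1), hWV.coe_mem_perforated j p hp⟩) :
    ∃ (E : ℂ → Matrix (Fin k) (Fin k) ℂ) (u : ℂ → ℂ), (∀ z, IsUnit (E z)) ∧
      ContinuousOn u (W j) ∧ (∀ τ ∈ W j, Complex.exp (u τ) = p - τ) ∧
      ∀ (t : Fin n → ℂ) (ht : t ∈ cylinder W), ∃ H : ℂ → Matrix (Fin k) (Fin k) ℂ,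
        (∀ x ∈ V j, IsUnit (H x)) ∧
        ∀ (x : (V j \ closure (W j) : Set ℂ)) (β : Path (⟨p, hp⟩ : (V j \ closure (W j) : Set ℂ)) x)
          (σ : C(unitInterval, ℂ)), σ 0 = u (t j) →
          (∀ s, Complex.exp (σ s) = (β s : ℂ) - t j) →
          perforatedSolution Y ht (Cov.mk _ ((Path.Homotopic.Quotient.mk α).trans
            ((Path.Homotopic.Quotient.mk β).map (coeMap (hWV.coe_mem_perforated j))))) =
            H x * E (σ 1) := by
  obtain ⟨E, hE, θ, hθc, hθ, hH⟩ := h j p hp (hWV.coe_mem_perforated j p hp) α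
  refine ⟨fun z => E (logPoint z), fun τ => Real.log ‖p - τ‖ + θ τ * Complex.I,
    fun z => hE.invertible _, ?_, fun τ hτ => hθ τ hτ, fun t ht => ?_⟩
  · refine ContinuousOn.add ?_ ?_
    · refine Complex.continuous_ofReal.comp_continuousOn (ContinuousOn.log (by fun_prop) ?_)
      intro τ hτ h0
      rw [norm_eq_zero, sub_eq_zero] at h0
      exact hp.2 (subset_closure (h0 ▸ hτ))
    · exact (Complex.continuous_ofReal.comp_continuousOn hθc).mul continuousOn_const
  · obtain ⟨H, -, hHu, hHf⟩ := hH t ht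
    refine ⟨H, hHu, fun x β σ h0 hσ => ?_⟩
    have hsub : V j \ closure (W j) ⊆ V j \ {t j} := fun z hz => mem_diff_singleton ht hz
    have key := hHf (Cov.mk _ (Path.Homotopic.Quotient.mk (β.map (continuous_inclusion hsub))))
    refine Eq.trans ?_ (key.trans ?_)
    · exact congrArg (fun q => Y t (Cov.mk _ q)) (quotient_map_trans (Path.Homotopic.Quotient.mk α)
        ((Path.Homotopic.Quotient.mk β).map (coeMap (hWV.coe_mem_perforated j)))
        (perforatedInclusion ht))
    · refine congrArg (H x * ·) (congrArg E ?_)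
      exact precomp_argPath_eq_logPoint (ζ := translation (t j) ⟨p, (hsub hp).2⟩) (hθ (t j) (ht j))
        ((β.map (continuous_inclusion hsub)).map
          ((translation (t j)).comp (diffInclusion (V j) (t j))).continuous) σ hσ h0

theorem one_add_mem_slitPlane {z : ℂ} (hz : ‖z‖ < 1) : 1 + z ∈ Complex.slitPlane :=
  Complex.mem_slitPlane_of_norm_lt_one hz

/-- A continuous branch of the logarithm of `p - τ` is locally given by the principal branch. -/
theorem eventually_eq_add_log {W : Set ℂ} {u : ℂ → ℂ} {p τ₀ : ℂ} (hu : ContinuousOn u W)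
    (hexp : ∀ τ ∈ W, Complex.exp (u τ) = p - τ) (h₀ : τ₀ ∈ W) :
    ∀ᶠ τ in 𝓝[W] τ₀, u τ = u τ₀ + Complex.log ((p - τ) / (p - τ₀)) := by
  have hne : p - τ₀ ≠ 0 := by
    rw [← hexp τ₀ h₀]
    exact Complex.exp_ne_zero _
  have hcont : ContinuousWithinAt (fun τ => u τ - u τ₀ - Complex.log ((p - τ) / (p - τ₀))) W τ₀ := by
    refine ((hu τ₀ h₀).sub continuousWithinAt_const).sub ?_
    refine ContinuousAt.continuousWithinAt ?_
    refine ContinuousAt.clog (by fun_prop) ?_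
    rw [div_self hne]
    exact Complex.one_mem_slitPlane
  have h0 : u τ₀ - u τ₀ - Complex.log ((p - τ₀) / (p - τ₀)) = 0 := by
    rw [div_self hne, Complex.log_one]
    ring
  rw [ContinuousWithinAt, h0] at hcont
  have hball := hcont (Metric.ball_mem_nhds (0 : ℂ) Real.pi_pos)
  filter_upwards [hball, self_mem_nhdsWithin] with τ hτ hτW
  have hneτ : p - τ ≠ 0 := by
    rw [← hexp τ hτW]
    exact Complex.exp_ne_zero _
  have he : Complex.exp (u τ - u τ₀ - Complex.log ((p - τ) / (p - τ₀))) = 1 := by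
    rw [Complex.exp_sub, Complex.exp_sub, hexp τ hτW, hexp τ₀ h₀,
      Complex.exp_log (div_ne_zero hneτ hne), div_self (div_ne_zero hneτ hne)]
  -- The discrepancy is a multiple of `2πi` of norm less than `π`, hence zero.
  obtain ⟨m, hm⟩ := Complex.exp_eq_one_iff.1 he
  have hτ' : ‖u τ - u τ₀ - Complex.log ((p - τ) / (p - τ₀))‖ < Real.pi := by
    simpa using hτ
  rw [hm] at hτ'
  have hm0 : m = 0 := by
    by_contra hm0
    have h1 : (1 : ℝ) ≤ |(m : ℝ)| := by exact_mod_cast Int.one_le_abs hm0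
    have h2 : ‖(m : ℂ) * (2 * Real.pi * Complex.I)‖ = |(m : ℝ)| * (2 * Real.pi) := by
      simp [abs_of_pos Real.pi_pos]
    rw [h2] at hτ'
    nlinarith [Real.pi_pos]
  rw [hm0, Int.cast_zero, zero_mul] at hm
  linear_combination hm

/-- Change of a continuous logarithm `σ` along a path `f` under a small perturbation `g` of the
path. -/
theorem exists_log_perturb (f g : C(unitInterval, ℂ)) (σ : C(unitInterval, ℂ))
    (hσ : ∀ s, Complex.exp (σ s) = f s) (hfg : ∀ s, ‖g s - f s‖ < ‖f s‖) :
    ∃ ρ : C(unitInterval, ℂ), (∀ s, Complex.exp (ρ s) = g s) ∧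
      ∀ s, ρ s = σ s + Complex.log (g s / f s) := by
  have hf : ∀ s, f s ≠ 0 := fun s => by
    rw [← hσ s]
    exact Complex.exp_ne_zero _
  have hslit : ∀ s, g s / f s ∈ Complex.slitPlane := by
    intro s
    have h1 : g s / f s = 1 + (g s - f s) / f s := by
      have := hf s
      field_simp
      ring
    rw [h1]
    refine one_add_mem_slitPlane ?_
    rw [norm_div, div_lt_one (norm_pos_iff.2 (hf s))]
    exact hfg s
  refine ⟨⟨fun s => σ s + Complex.log (g s / f s), ?_⟩, fun s => ?_, fun s => rfl⟩
  · exact σ.continuous.add ((g.continuous.div f.continuous hf).clog hslit)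
  · change Complex.exp (σ s + Complex.log (g s / f s)) = g s
    have hne := Complex.slitPlane_ne_zero (hslit s)
    rw [Complex.exp_add, hσ, Complex.exp_log hne, mul_div_cancel₀ _ (hf s)]

/-! ### Independence of the local monodromy from the parameter -/

section Local

variable {n k : ℕ} {D : Set (Fin n → ℂ)}
  {Y : ∀ t : Fin n → ℂ, Cov (puncturedInfty t) → Matrix (Fin k) (Fin k) ℂ} {t₀ : Fin n → ℂ}
  {W V : Fin n → Set ℂ} {hWV : IsNestedPair D t₀ W V}

/-- The local monodromy matrix of the branch `α` in `Vⱼ ∖ closure Wⱼ` along the loop `δ`. -/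
noncomputable def localMonodromy (Y : ∀ t : Fin n → ℂ, Cov (puncturedInfty t) →
    Matrix (Fin k) (Fin k) ℂ) (hWV : IsNestedPair D t₀ W V) {j : Fin n} {p : ℂ}
    {hp : p ∈ V j \ closure (W j)}
    (α : Path (perforatedInfty W) ⟨(p : CP1), hWV.coe_mem_perforated j p hp⟩)
    (δ : Path (⟨p, hp⟩ : (V j \ closure (W j) : Set ℂ)) ⟨p, hp⟩) {t : Fin n → ℂ}
    (ht : t ∈ cylinder W) : Matrix (Fin k) (Fin k) ℂ :=
  (perforatedSolution Y ht (Cov.mk _ (Path.Homotopic.Quotient.mk α)))⁻¹ *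
    perforatedSolution Y ht (Cov.mk _ ((Path.Homotopic.Quotient.mk α).trans
      ((Path.Homotopic.Quotient.mk δ).map (coeMap (hWV.coe_mem_perforated j)))))

/-- The monodromy for `s` is computed at `p` and the one for `t` at the shifted point `x = p - s j +
t j`. Since `x - t j = p - s j`, the same values of `E` occur in both, and the factors `H` cancel.
-/
theorem IsoprincipalOn.localMonodromy_eventually (h : IsoprincipalOn Y hWV)
    (hmono : ∀ (t : Fin n → ℂ) (ht : t ∈ cylinder W), HasMonodromy (perforatedSolution Y ht))
    {j : Fin n} {p : ℂ} {hp : p ∈ V j \ closure (W j)}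
    (α : Path (perforatedInfty W) ⟨(p : CP1), hWV.coe_mem_perforated j p hp⟩)
    (δ : Path (⟨p, hp⟩ : (V j \ closure (W j) : Set ℂ)) ⟨p, hp⟩) {t : Fin n → ℂ}
    (ht : t ∈ cylinder W) :
    ∀ᶠ τ in 𝓝[W j] (t j), ∀ (s : Fin n → ℂ) (hs : s ∈ cylinder W), s j = τ →
      localMonodromy Y hWV α δ hs = localMonodromy Y hWV α δ ht := by
  obtain ⟨E, u, hE, hu, hexp, hH⟩ := h.exists_log_factor j p hp α
  set τ₀ := t j with hτ₀
  have hτ₀W : τ₀ ∈ W j := ht j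
  obtain ⟨r₁, hr₁, hball₁⟩ := Metric.isOpen_iff.1 (hWV.nhd_inner.isOpen j) τ₀ hτ₀W
  obtain ⟨r₂, hr₂, hball₂⟩ := Metric.isOpen_iff.1 (hWV.isOpen_diff j) p hp
  -- The disc of radius `r₁` about `τ₀` lies in `W j`, so a displacement of the pole by less than
  -- `r₁` is a small perturbation along every path in the annular domain.
  have hfar : ∀ z ∈ V j \ closure (W j), r₁ ≤ ‖z - τ₀‖ := by
    intro z hz
    by_contra! hlt
    exact hz.2 (subset_closure (hball₁ (by rwa [Metric.mem_ball, dist_eq_norm])))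
  obtain ⟨σ₀, hσ₀0, hσ₀⟩ := exists_log_along ⟨fun s => (δ s : ℂ) - τ₀, by fun_prop⟩
    (fun s h0 => by
      have := hfar _ (δ s).2
      rw [show (δ s : ℂ) - τ₀ = 0 from h0, norm_zero] at this
      linarith) (u τ₀) (by
      rw [hexp τ₀ hτ₀W]
      change p - τ₀ = (δ 0 : ℂ) - τ₀
      rw [δ.source])
  -- The increment of the logarithm along the loop, a period of the exponential.
  set c := σ₀ 1 - u τ₀ with hc
  have hexpc : Complex.exp c = 1 := by
    have h1 : Complex.exp (σ₀ 1) = p - τ₀ := by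
      rw [hσ₀ 1]
      change (δ 1 : ℂ) - τ₀ = _
      rw [δ.target]
    rw [hc, Complex.exp_sub, h1, hexp τ₀ hτ₀W, div_self]
    rw [← hexp τ₀ hτ₀W]
    exact Complex.exp_ne_zero _
  have hnear : ∀ᶠ τ in 𝓝[W j] τ₀, ‖τ - τ₀‖ < min r₁ r₂ := by
    refine nhdsWithin_le_nhds ?_
    have := Metric.ball_mem_nhds τ₀ (lt_min hr₁ hr₂)
    filter_upwards [this] with τ hτ
    rwa [← dist_eq_norm]
  filter_upwards [hnear, self_mem_nhdsWithin, eventually_eq_add_log hu hexp hτ₀W]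
    with τ hτ hτW huτ s hs hsj
  subst hsj
  have hτ1 : ‖s j - τ₀‖ < r₁ := hτ.trans_le (min_le_left _ _)
  set S := V j \ closure (W j) with hS
  set ι := coeMap (hWV.coe_mem_perforated j) with hι
  set ℓ := Complex.log ((p - s j) / (p - τ₀)) with hℓ
  obtain ⟨H, hHu, hHf⟩ := hH s hs
  obtain ⟨H₀, hH₀u, hH₀f⟩ := hH t ht
  have e1 : perforatedSolution Y hs (Cov.mk _ (Path.Homotopic.Quotient.mk α)) =
      H p * E (u τ₀ + ℓ) := by
    have := hHf ⟨p, hp⟩ (Path.refl _) (ContinuousMap.const _ (u (s j))) rfl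
      (fun _ => hexp (s j) hτW)
    rw [Path.Homotopic.Quotient.mk_refl] at this
    rw [← huτ]
    refine Eq.trans (congrArg (fun q => perforatedSolution Y hs (Cov.mk _ q)) ?_) this
    exact (Path.Homotopic.Quotient.trans_refl _).symm
  have e2 : perforatedSolution Y hs (Cov.mk _ ((Path.Homotopic.Quotient.mk α).trans
      ((Path.Homotopic.Quotient.mk δ).map ι))) = H p * E (u τ₀ + c + ℓ) := by
    -- Displacing the pole adds the same term `ℓ` to the logarithm at both ends of the closed path
    -- `δ`, so the increment `c` is unchanged.
    obtain ⟨ρ, hρ, hρ'⟩ := exists_log_perturb ⟨fun s => (δ s : ℂ) - τ₀, by fun_prop⟩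
      ⟨fun v => (δ v : ℂ) - s j, by fun_prop⟩ σ₀ hσ₀ (fun v => by
        change ‖((δ v : ℂ) - s j) - ((δ v : ℂ) - τ₀)‖ < ‖(δ v : ℂ) - τ₀‖
        rw [sub_sub_sub_cancel_left, norm_sub_rev]
        exact hτ1.trans_le (hfar _ (δ v).2))
    have h0 : ρ 0 = u (s j) := by
      rw [hρ', hσ₀0, huτ]
      change u τ₀ + Complex.log (((δ 0 : ℂ) - s j) / ((δ 0 : ℂ) - τ₀)) = _
      rw [δ.source]
    have h1 : ρ 1 = u τ₀ + c + ℓ := by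
      rw [hρ']
      change σ₀ 1 + Complex.log (((δ 1 : ℂ) - s j) / ((δ 1 : ℂ) - τ₀)) = _
      rw [δ.target, hc]
      ring
    rw [← h1]
    exact hHf ⟨p, hp⟩ δ ρ h0 hρ
  -- The radius `r₂` keeps the move from `p` to `x` inside the annular domain; `r₁` keeps the
  -- principal logarithm valid along it.
  set x : ℂ := p - s j + τ₀ with hx
  have hxball : x ∈ Metric.ball p (min r₁ r₂) := by
    rw [Metric.mem_ball, dist_eq_norm, hx, show p - s j + τ₀ - p = -(s j - τ₀) by ring, norm_neg]
    exact hτ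
  have hball : Metric.ball p (min r₁ r₂) ⊆ S :=
    (Metric.ball_subset_ball (min_le_right _ _)).trans hball₂
  have hpath : ∃ β : Path (⟨p, hp⟩ : S) ⟨x, hball hxball⟩,
      ∀ v, (β v : ℂ) ∈ Metric.ball p (min r₁ r₂) := by
    have hpc : IsPathConnected (Metric.ball p (min r₁ r₂)) :=
      (convex_ball _ _).isPathConnected ⟨p, Metric.mem_ball_self (lt_min hr₁ hr₂)⟩
    have := isPathConnected_iff_pathConnectedSpace.1 hpc
    let β := PathConnectedSpace.somePath
      (⟨p, Metric.mem_ball_self (lt_min hr₁ hr₂)⟩ : Metric.ball p (min r₁ r₂)) ⟨x, hxball⟩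
    exact ⟨β.map (continuous_inclusion hball), fun v => (β v).2⟩
  obtain ⟨β, hβ⟩ := hpath
  obtain ⟨ρ, hρ, hρ'⟩ := exists_log_perturb (ContinuousMap.const _ (p - τ₀))
    ⟨fun v => (β v : ℂ) - τ₀, by fun_prop⟩ (ContinuousMap.const _ (u τ₀))
    (fun _ => hexp τ₀ hτ₀W) (fun v => by
      change ‖((β v : ℂ) - τ₀) - (p - τ₀)‖ < ‖p - τ₀‖
      rw [sub_sub_sub_cancel_right, ← dist_eq_norm]
      have := hβ v
      rw [Metric.mem_ball] at this
      exact (this.trans_le (min_le_left _ _)).trans_le (hfar p hp))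
  have hρ0 : ρ 0 = u τ₀ := by
    rw [hρ']
    change u τ₀ + Complex.log (((β 0 : ℂ) - τ₀) / (p - τ₀)) = _
    rw [β.source, div_self, Complex.log_one, add_zero]
    rw [← hexp τ₀ hτ₀W]
    exact Complex.exp_ne_zero _
  have hρ1 : ρ 1 = u τ₀ + ℓ := by
    rw [hρ']
    change u τ₀ + Complex.log (((β 1 : ℂ) - τ₀) / (p - τ₀)) = _
    rw [β.target, hℓ]
    congr 3
    change x - τ₀ = _
    rw [hx]
    ring
  have e3 := hH₀f _ β ρ hρ0 hρ
  -- After the loop the logarithm along `β` starts at a value larger by `c`; the shift `ρ + c` is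
  -- still a logarithm because `exp c = 1`.
  obtain ⟨σ, hσ, hσ0, hσ1⟩ := exists_log_trans δ β (fun z => (z : ℂ) - τ₀) σ₀
    ⟨fun v => ρ v + c, by fun_prop⟩ hσ₀ (fun v => by
      change Complex.exp (ρ v + c) = _
      rw [Complex.exp_add, hexpc, mul_one]
      exact hρ v) (by
      change σ₀ 1 = ρ 0 + c
      rw [hρ0, hc]
      ring)
  have e4 := hH₀f _ (δ.trans β) σ (hσ0.trans hσ₀0) hσ
  have hσ1' : σ 1 = u τ₀ + c + ℓ := by
    rw [hσ1]
    change ρ 1 + c = _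
    rw [hρ1]
    ring
  have key := (hmono t ht).inv_mul_trans (Path.Homotopic.Quotient.mk α)
    ((Path.Homotopic.Quotient.mk δ).map ι) ((Path.Homotopic.Quotient.mk β).map ι)
  have e5 : perforatedSolution Y ht (Cov.mk _ ((Path.Homotopic.Quotient.mk α).trans
      (((Path.Homotopic.Quotient.mk δ).map ι).trans ((Path.Homotopic.Quotient.mk β).map ι)))) =
      H₀ x * E (u τ₀ + c + ℓ) := by
    rw [← hσ1', ← e4]
    refine congrArg (fun q => perforatedSolution Y ht (Cov.mk _ q)) ?_
    refine congrArg ((Path.Homotopic.Quotient.mk α).trans ·) ?_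
    rw [Path.Homotopic.Quotient.mk_trans]
    exact (quotient_map_trans _ _ _).symm
  rw [hρ1] at e3
  have key' := (congrArg₂ (fun A B => A⁻¹ * B) e3 e5).symm.trans key
  have canc : ∀ (A B C : Matrix (Fin k) (Fin k) ℂ), IsUnit A → (A * B)⁻¹ * (A * C) = B⁻¹ * C := by
    intro A B C hA
    rw [Matrix.mul_inv_rev, mul_assoc,
      Matrix.nonsing_inv_mul_cancel_left _ _ ((Matrix.isUnit_iff_isUnit_det _).1 hA)]
  rw [localMonodromy, localMonodromy, e1, e2, canc _ _ _ (hHu p hp.1),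
    ← canc _ _ _ (hH₀u x (hball hxball).1)]
  exact key'

/-- The local monodromy matrices of an isoprincipal family do not depend on the parameter. -/
theorem IsoprincipalOn.localMonodromy_eq (h : IsoprincipalOn Y hWV)
    (hmono : ∀ (t : Fin n → ℂ) (ht : t ∈ cylinder W), HasMonodromy (perforatedSolution Y ht))
    {j : Fin n} {p : ℂ} {hp : p ∈ V j \ closure (W j)}
    (α : Path (perforatedInfty W) ⟨(p : CP1), hWV.coe_mem_perforated j p hp⟩)
    (δ : Path (⟨p, hp⟩ : (V j \ closure (W j) : Set ℂ)) ⟨p, hp⟩) {t' t'' : Fin n → ℂ}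
    (ht' : t' ∈ cylinder W) (ht'' : t'' ∈ cylinder W) :
    localMonodromy Y hWV α δ ht' = localMonodromy Y hWV α δ ht'' := by
  have hmem : ∀ τ ∈ W j, Function.update t' j τ ∈ cylinder W := by
    intro τ hτ l
    by_cases hl : l = j
    · subst hl
      simpa using hτ
    · simpa [Function.update_of_ne hl] using ht' l
  have hconn := (hWV.nhd_inner.simplyConnected j).isPathConnected.isConnected.isPreconnected
  -- The relation quantifies over all parameters with prescribed `j`-th coordinate, so only `W j`
  -- has to be connected; `Function.update` supplies intermediate parameters.
  refine hconn.induction₂ (fun a b => ∀ (s s' : Fin n → ℂ) (hs : s ∈ cylinder W)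
    (hs' : s' ∈ cylinder W), s j = a → s' j = b →
    localMonodromy Y hWV α δ hs = localMonodromy Y hWV α δ hs') ?_ ?_ ?_ (ht' j) (ht'' j) t' t''
    ht' ht'' rfl rfl
  · intro a ha
    have h1 := h.localMonodromy_eventually hmono α δ (hmem a ha)
    rw [Function.update_self] at h1
    have h2 := h1.self_of_nhdsWithin ha
    filter_upwards [h1] with b hb s s' hs hs' hsa hsb
    rw [h2 s hs hsa, hb s' hs' hsb]
  · intro a b c _ hb _ h1 h2 s s' hs hs' hsa hsc
    rw [h1 s _ hs (hmem b hb) hsa (Function.update_self _ _ _),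
      h2 _ s' (hmem b hb) hs' (Function.update_self _ _ _) hsc]
  · intro a b _ _ h1 s s' hs hs' hsb hsa
    exact (h1 s' s hs' hs hsa hsb).symm

end Local

theorem isPreconnected_lt_norm {R : ℝ} (hR : 0 < R) : IsPreconnected {z : ℂ | R < ‖z‖} := by
  have h : {z : ℂ | R < ‖z‖} = Complex.exp '' {w : ℂ | Real.log R < w.re} := by
    ext z
    constructor
    · intro hz
      have hz' : R < ‖z‖ := hz
      have hz0 : z ≠ 0 := norm_pos_iff.1 (hR.trans hz')
      refine ⟨Complex.log z, ?_, Complex.exp_log hz0⟩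
      change Real.log R < (Complex.log z).re
      rw [Complex.log_re]
      exact Real.log_lt_log hR hz'
    · rintro ⟨w, hw, rfl⟩
      change R < ‖Complex.exp w‖
      rw [Complex.norm_exp, ← Real.log_lt_iff_lt_exp hR]
      exact hw
  rw [h]
  exact (convex_halfSpace_re_gt _).isPreconnected.image _ Complex.continuous_exp.continuousOn

/-- A path in a subset of the sphere that lies in a plane set is a path in that plane set. -/
theorem exists_path_map_coeMap {S : Set CP1} {U : Set ℂ} (h : ∀ z ∈ U, (z : CP1) ∈ S)
    (x y : U) (β : Path (coeMap h x) (coeMap h y)) (hβ : ∀ s, ∃ z ∈ U, (β s : CP1) = z) :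
    ∃ β' : Path x y, β = β'.map (coeMap h).continuous := by
  have hne : ∀ s, (β s : CP1) ≠ ∞ := by
    intro s
    obtain ⟨z, -, hz⟩ := hβ s
    rw [hz]
    exact OnePoint.coe_ne_infty z
  have hmem : ∀ s, affineCoord (β s : CP1) ∈ U := by
    intro s
    obtain ⟨z, hz, hzs⟩ := hβ s
    rw [hzs]
    exact hz
  have hc : Continuous fun s => affineCoord (β s : CP1) := by
    rw [continuous_iff_continuousAt]
    intro s
    exact ContinuousAt.comp (g := affineCoord) (continuousAt_affineCoord (hne s))
      (continuous_subtype_val.comp β.continuous).continuousAt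
  refine ⟨⟨⟨fun s => ⟨affineCoord (β s : CP1), hmem s⟩, hc.subtype_mk _⟩, ?_, ?_⟩, ?_⟩
  · refine Subtype.ext ?_
    change affineCoord (β 0 : CP1) = x
    rw [β.source]
    rfl
  · refine Subtype.ext ?_
    change affineCoord (β 1 : CP1) = y
    rw [β.target]
    rfl
  · ext s
    exact eq_coe_affineCoord (hne s)

/-! ### Branches of a multivalued function over plane sets -/

section Global

variable {S : Set CP1} {x₀ : S} {A : Type*}

/-- The function `f` is a branch in the plane set `U` of the function `r` on the universal covering
space of the subset `S` of the sphere. -/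
def IsCovBranch (r : Cov x₀ → A) (U : Set ℂ) (f : ℂ → A) : Prop :=
  (∀ z ∈ U, ∃ P : Cov x₀, (P.1 : CP1) = z ∧ r P = f z) ∧
    ∀ (P : Cov x₀) (y : S) (β : Path P.1 y), (∀ s, ∃ z ∈ U, (β s : CP1) = z) →
      r P = f (affineCoord P.1) →
      r (Cov.mk y (P.2.trans (Path.Homotopic.Quotient.mk β))) = f (affineCoord y)

/-- Coincidence of the values of `r` on two points of the universal covering space over one point
propagates along paths, in both directions. -/
def Transports (r : Cov x₀ → A) : Prop :=
  ∀ (x y : S) (α α' : Path.Homotopic.Quotient x₀ x) (β : Path.Homotopic.Quotient x y),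
    r (Cov.mk y (α.trans β)) = r (Cov.mk y (α'.trans β)) ↔ r (Cov.mk x α) = r (Cov.mk x α')

variable {r : Cov x₀ → A} {U U' : Set ℂ} {f g : ℂ → A}

theorem IsCovBranch.mono (h : IsCovBranch r U f) (hU : U' ⊆ U) : IsCovBranch r U' f :=
  ⟨fun z hz => h.1 z (hU hz), fun P y β hβ => h.2 P y β fun s =>
    (hβ s).imp fun _ hz => ⟨hU hz.1, hz.2⟩⟩

theorem IsCovBranch.congr (h : IsCovBranch r U f) (hfg : Set.EqOn f g U) : IsCovBranch r U g := by
  refine ⟨fun z hz => ?_, fun P y β hβ hP => ?_⟩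
  · rw [← hfg hz]
    exact h.1 z hz
  · have hmem : ∀ s, affineCoord (β s : CP1) ∈ U := by
      intro s
      obtain ⟨z, hz, hzs⟩ := hβ s
      rw [hzs]
      exact hz
    have h0 := hmem 0
    have h1 := hmem 1
    rw [β.source] at h0
    rw [β.target] at h1
    rw [← hfg h0] at hP
    rw [← hfg h1]
    exact h.2 P y β hβ hP

theorem IsCovBranch.subset (h : IsCovBranch r U f) : ∀ z ∈ U, (z : CP1) ∈ S := by
  intro z hz
  obtain ⟨P, hP, -⟩ := h.1 z hz
  exact hP ▸ P.1.2

/-- Both branches are continued along one path in `U` from the same point of the covering, where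
they share the value of `r`. -/
theorem IsCovBranch.eq_of_eq (hf : IsCovBranch r U f) (hg : IsCovBranch r U g)
    (hU : IsPathConnected U) {x y : ℂ} (hx : x ∈ U) (hy : y ∈ U) (h : f x = g x) : f y = g y := by
  obtain ⟨⟨⟨x', hx'⟩, α⟩, hP, hr⟩ := hf.1 x hx
  change x' = x at hP
  subst hP
  obtain ⟨β, hβ⟩ := exists_path_coe hU hf.subset hx hy
  exact (hf.2 ⟨_, α⟩ _ β hβ hr).symm.trans (hg.2 ⟨_, α⟩ _ β hβ (hr.trans h))

theorem IsCovBranch.eq_iff (hf : IsCovBranch r U f) (hg : IsCovBranch r U g)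
    (hU : IsPathConnected U) {x y : ℂ} (hx : x ∈ U) (hy : y ∈ U) : f x = g x ↔ f y = g y :=
  ⟨hf.eq_of_eq hg hU hx hy, hf.eq_of_eq hg hU hy hx⟩

/-- The branch is obtained by continuing `P` along an arbitrary path inside `U` to each point, and
`hind` makes the choice harmless. `Transports` handles other points of the covering with the same
value of `r`. -/
theorem exists_isCovBranch (hT : Transports r) (hU : IsPathConnected U)
    (hS : ∀ z ∈ U, (z : CP1) ∈ S)
    (hind : ∀ (P : Cov x₀) (y : S) (β β' : Path P.1 y), (∀ s, ∃ z ∈ U, (β s : CP1) = z) →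
      (∀ s, ∃ z ∈ U, (β' s : CP1) = z) →
      r (Cov.mk y (P.2.trans (Path.Homotopic.Quotient.mk β))) =
        r (Cov.mk y (P.2.trans (Path.Homotopic.Quotient.mk β'))))
    {p : ℂ} (hp : p ∈ U) (P : Cov x₀) (hP : (P.1 : CP1) = p) :
    ∃ f, IsCovBranch r U f ∧ f p = r P := by
  classical
  obtain ⟨⟨p', hp'⟩, α⟩ := P
  change p' = p at hP
  subst hP
  choose β hβ using fun (z : ℂ) (hz : z ∈ U) => exists_path_coe hU hS hp hz
  set f : ℂ → A := fun z => if hz : z ∈ U then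
    r (Cov.mk _ (α.trans (Path.Homotopic.Quotient.mk (β z hz)))) else r ⟨_, α⟩ with hf
  have hfU : ∀ (z : ℂ) (hz : z ∈ U),
      f z = r (Cov.mk _ (α.trans (Path.Homotopic.Quotient.mk (β z hz)))) := fun z hz => dif_pos hz
  refine ⟨f, ⟨fun z hz => ⟨Cov.mk _ (α.trans (Path.Homotopic.Quotient.mk (β z hz))), rfl,
    (hfU z hz).symm⟩, ?_⟩, ?_⟩
  · rintro ⟨⟨x, hx⟩, α'⟩ ⟨y, hy⟩ γ hγ hr
    obtain ⟨z, hz, hzx⟩ := hγ 0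
    obtain ⟨w, hw, hwy⟩ := hγ 1
    rw [γ.source] at hzx
    rw [γ.target] at hwy
    change x = z at hzx
    change y = w at hwy
    subst hzx hwy
    change r ⟨_, α'⟩ = f z at hr
    change r (Cov.mk _ (α'.trans (Path.Homotopic.Quotient.mk γ))) = f w
    rw [hfU z hz] at hr
    rw [hfU w hw]
    have h1 := (hT _ _ α' (α.trans (Path.Homotopic.Quotient.mk (β z hz)))
      (Path.Homotopic.Quotient.mk γ)).2 hr
    rw [h1, Path.Homotopic.Quotient.trans_assoc, ← Path.Homotopic.Quotient.mk_trans]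
    refine hind ⟨_, α⟩ _ _ _ (fun s => ?_) (hβ w hw)
    have hs : ((β z hz).trans γ) s ∈ Set.range ((β z hz).trans γ) := ⟨s, rfl⟩
    rw [Path.trans_range] at hs
    rcases hs with ⟨u, hu⟩ | ⟨u, hu⟩
    · rw [← hu]
      exact hβ z hz u
    · rw [← hu]
      exact hγ u
  · rw [hfU p hp]
    refine (hind ⟨_, α⟩ _ (β p hp) (Path.refl _) (hβ p hp) fun s => ⟨p, hp, rfl⟩).trans ?_
    rw [Path.Homotopic.Quotient.mk_refl]
    exact congrArg (fun q => r (Cov.mk _ q)) (Path.Homotopic.Quotient.trans_refl α)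

theorem exists_isCovBranch_ball (hT : Transports r) {c : ℂ} {ρ : ℝ}
    (hS : ∀ z ∈ Metric.ball c ρ, (z : CP1) ∈ S) {p : ℂ} (hp : p ∈ Metric.ball c ρ) (P : Cov x₀)
    (hP : (P.1 : CP1) = p) : ∃ f, IsCovBranch r (Metric.ball c ρ) f ∧ f p = r P := by
  refine exists_isCovBranch hT ((convex_ball c ρ).isPathConnected ⟨p, hp⟩) hS ?_ hp P hP
  rintro ⟨⟨x, hx⟩, α⟩ ⟨y, hy⟩ β β' hβ hβ'
  obtain ⟨z, hz, hzx⟩ := hβ 0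
  obtain ⟨w, hw, hwy⟩ := hβ 1
  rw [β.source] at hzx
  rw [β.target] at hwy
  change x = z at hzx
  change y = w at hwy
  subst hzx hwy
  obtain ⟨b, rfl⟩ := exists_path_map_coeMap hS ⟨z, hz⟩ ⟨w, hw⟩ β hβ
  obtain ⟨b', rfl⟩ := exists_path_map_coeMap hS ⟨z, hz⟩ ⟨w, hw⟩ β' hβ'
  have := (convex_ball c ρ).contractibleSpace ⟨p, hp⟩
  have hb : b.Homotopic b' := SimplyConnectedSpace.paths_homotopic b b'
  refine congrArg (fun q => r (Cov.mk _ (α.trans q))) ?_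
  exact Path.Homotopic.Quotient.eq.2 (hb.map (coeMap hS))

/-- Two paths in `U` with common ends differ by a loop in `U`, which by `hloop` leaves `r`
unchanged. -/
theorem exists_isCovBranch_of_loops (hT : Transports r) (hU : IsPathConnected U)
    (hS : ∀ z ∈ U, (z : CP1) ∈ S)
    (hloop : ∀ (p : U) (α : Path.Homotopic.Quotient x₀ (coeMap hS p)) (δ : Path p p),
      r (Cov.mk _ (α.trans ((Path.Homotopic.Quotient.mk δ).map (coeMap hS)))) = r (Cov.mk _ α))
    {p : ℂ} (hp : p ∈ U) (P : Cov x₀) (hP : (P.1 : CP1) = p) :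
    ∃ f, IsCovBranch r U f ∧ f p = r P := by
  refine exists_isCovBranch hT hU hS ?_ hp P hP
  rintro ⟨⟨x, hx⟩, α⟩ ⟨y, hy⟩ β β' hβ hβ'
  obtain ⟨z, hz, hzx⟩ := hβ 0
  obtain ⟨w, hw, hwy⟩ := hβ 1
  rw [β.source] at hzx
  rw [β.target] at hwy
  change x = z at hzx
  change y = w at hwy
  subst hzx hwy
  obtain ⟨b, rfl⟩ := exists_path_map_coeMap hS ⟨z, hz⟩ ⟨w, hw⟩ β hβ
  obtain ⟨b', rfl⟩ := exists_path_map_coeMap hS ⟨z, hz⟩ ⟨w, hw⟩ β' hβ'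
  have h1 := (hT _ _ _ α ((Path.Homotopic.Quotient.mk b').map (coeMap hS))).2
    (hloop ⟨z, hz⟩ α (b.trans b'.symm))
  refine Eq.trans (congrArg (fun q => r (Cov.mk _ q)) ?_) h1
  refine Eq.trans (congrArg (α.trans ·) ?_) (Path.Homotopic.Quotient.trans_assoc α
    ((Path.Homotopic.Quotient.mk (b.trans b'.symm)).map (coeMap hS))
    ((Path.Homotopic.Quotient.mk b').map (coeMap hS))).symm
  have hb : (Path.Homotopic.Quotient.mk b).map (coeMap hS) =
      ((Path.Homotopic.Quotient.mk (b.trans b'.symm)).map (coeMap hS)).trans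
        ((Path.Homotopic.Quotient.mk b').map (coeMap hS)) := by
    rw [← quotient_map_trans, Path.Homotopic.Quotient.mk_trans,
      Path.Homotopic.Quotient.trans_assoc, Path.Homotopic.Quotient.mk_symm,
      Path.Homotopic.Quotient.symm_trans, Path.Homotopic.Quotient.trans_refl]
  exact hb

end Global

/-! ### Filling the holes and descent to the perforated sphere -/

section Global

variable {n : ℕ} {D : Set (Fin n → ℂ)} {t₀ : Fin n → ℂ} {W V : Fin n → Set ℂ} {A : Type*}
  {r : Cov (perforatedInfty W) → A}

theorem isOpen_setOf_coe_mem_perforated (W : Fin n → Set ℂ) :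
    IsOpen {z : ℂ | (z : CP1) ∈ perforatedSphere W} := by
  have : {z : ℂ | (z : CP1) ∈ perforatedSphere W} = ⋂ j, (closure (W j))ᶜ := by
    ext z
    rw [Set.mem_iInter]
    exact IsNestedPair.coe_mem_perforated_iff
  rw [this]
  exact isOpen_iInter_of_finite fun j => isClosed_closure.isOpen_compl

theorem IsNestedPair.exists_radius (h : IsNestedPair D t₀ W V) :
    ∃ R : ℝ, ∀ z : ℂ, R < ‖z‖ → (z : CP1) ∈ perforatedSphere W := by
  obtain ⟨R, hR⟩ := (isCompact_iUnion fun j => h.isCompact_closure j).isBounded.exists_norm_le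
  refine ⟨R, fun z hz => IsNestedPair.coe_mem_perforated_iff.2 fun j hj => ?_⟩
  exact absurd (hR z (Set.mem_iUnion.2 ⟨j, hj⟩)) (not_le.2 hz)

open Classical in
/-- A map of the plane into the perforated plane that is the identity on the perforated plane and
maps each `closure Wⱼ` to a point of `Vⱼ ∖ closure Wⱼ`. -/
noncomputable def IsNestedPair.push (h : IsNestedPair D t₀ W V) (z : ℂ) : ℂ :=
  if hz : ∃ j, z ∈ closure (W j) then (h.isPathConnected_diff hz.choose).nonempty.choose else z

theorem IsNestedPair.push_of_mem (h : IsNestedPair D t₀ W V) {z : ℂ}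
    (hz : (z : CP1) ∈ perforatedSphere W) : h.push z = z := by
  rw [IsNestedPair.coe_mem_perforated_iff] at hz
  exact dif_neg fun ⟨j, hj⟩ => hz j hj

theorem IsNestedPair.push_mem_diff (h : IsNestedPair D t₀ W V) {j : Fin n} {z : ℂ}
    (hz : z ∈ V j) : h.push z ∈ V j \ closure (W j) := by
  by_cases hW : ∃ i, z ∈ closure (W i)
  · have h1 : h.push z = (h.isPathConnected_diff hW.choose).nonempty.choose := dif_pos hW
    have h2 : hW.choose = j := by
      by_contra hne
      exact h.disjoint_outer hne (h.closure_subset _ hW.choose_spec) hz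
    have h3 := (h.isPathConnected_diff hW.choose).nonempty.choose_spec
    rw [h1]
    rwa [h2] at h3 ⊢
  · have h1 : h.push z = z := dif_neg hW
    rw [h1]
    exact ⟨hz, fun hj => hW ⟨j, hj⟩⟩

/-- The system of the branches of the function `r`, extended to the whole plane. -/
noncomputable def perforatedBranches (hWV : IsNestedPair D t₀ W V) (hT : Transports r)
    (hloop : ∀ (j : Fin n) (p : (V j \ closure (W j) : Set ℂ))
      (α : Path.Homotopic.Quotient (perforatedInfty W) (coeMap (hWV.coe_mem_perforated j) p))
      (δ : Path p p), r (Cov.mk _ (α.trans ((Path.Homotopic.Quotient.mk δ).map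
        (coeMap (hWV.coe_mem_perforated j))))) = r (Cov.mk _ α)) : BranchSystem A where
  -- Over the whole of `V j` a section is a branch on the annular domain composed with `push`,
  -- constant on the hole; no continuity is needed, since only coincidences of sections matter.
  Sec U f := (∃ j F, U = V j ∧ IsCovBranch r (V j \ closure (W j)) F ∧ ∀ z, f z = F (hWV.push z)) ∨
    ∃ c ρ, U = Metric.ball c ρ ∧ IsCovBranch r (Metric.ball c ρ) f
  Val z a := ∃ P : Cov (perforatedInfty W), (P.1 : CP1) = (hWV.push z : ℂ) ∧ r P = a
  isOpen := by
    rintro U f (⟨j, F, rfl, -⟩ | ⟨c, ρ, rfl, -⟩)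
    · exact hWV.nhd_outer.isOpen j
    · exact Metric.isOpen_ball
  exists_nhd := by
    intro x
    by_cases hx : (x : CP1) ∈ perforatedSphere W
    · obtain ⟨ρ, hρ, hball⟩ := Metric.isOpen_iff.1 (isOpen_setOf_coe_mem_perforated W) x hx
      refine ⟨_, Metric.ball_mem_nhds x hρ, ?_⟩
      rintro y hy a ⟨P, hP, rfl⟩
      rw [hWV.push_of_mem (hball hy)] at hP
      obtain ⟨f, hf, hfy⟩ := exists_isCovBranch_ball hT (fun z hz => hball hz) hy P hP
      exact ⟨f, Or.inr ⟨x, ρ, rfl, hf⟩, hfy⟩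
    · rw [IsNestedPair.coe_mem_perforated_iff] at hx
      push Not at hx
      obtain ⟨j, hj⟩ := hx
      refine ⟨V j, (hWV.nhd_outer.isOpen j).mem_nhds (hWV.closure_subset j hj), ?_⟩
      rintro y hy a ⟨P, hP, rfl⟩
      obtain ⟨F, hF, hFy⟩ := exists_isCovBranch_of_loops hT (hWV.isPathConnected_diff j)
        (hWV.coe_mem_perforated j) (hloop j) (hWV.push_mem_diff hy) P hP
      exact ⟨fun z => F (hWV.push z), Or.inl ⟨j, F, rfl, hF, fun _ => rfl⟩, hFy⟩
  discrete := by
    have hmixed : ∀ {U₁ U₂ : Set ℂ} {f g f' g' : ℂ → A} {x : ℂ}, IsOpen U₁ → IsOpen U₂ →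
        x ∈ U₁ → x ∈ U₂ → IsCovBranch r U₁ f → IsCovBranch r U₂ g →
        (∀ z ∈ U₁, f' z = f z) → (∀ z ∈ U₂, g' z = g z) →
        ∀ᶠ y in 𝓝 x, (f' y = g' y ↔ f' x = g' x) := by
      intro U₁ U₂ f g f' g' x hU₁ hU₂ h₁ h₂ hf hg hff hgg
      obtain ⟨ρ, hρ, hball⟩ := Metric.isOpen_iff.1 (hU₁.inter hU₂) x ⟨h₁, h₂⟩
      filter_upwards [Metric.ball_mem_nhds x hρ] with y hy
      rw [hff y (hball hy).1, hff x h₁, hgg y (hball hy).2, hgg x h₂]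
      exact (hf.mono fun z hz => (hball hz).1).eq_iff (hg.mono fun z hz => (hball hz).2)
        ((convex_ball x ρ).isPathConnected ⟨x, Metric.mem_ball_self hρ⟩) hy
        (Metric.mem_ball_self hρ)
    have hpush : ∀ {j : Fin n} {F f : ℂ → A}, (∀ z, f z = F (hWV.push z)) →
        ∀ z ∈ V j \ closure (W j), f z = F z := by
      intro j F f hfF z hz
      rw [hfF, hWV.push_of_mem (hWV.coe_mem_perforated j z hz)]
    rintro U₁ U₂ f g x (⟨j, F, rfl, hF, hfF⟩ | ⟨c, ρ, rfl, hf⟩)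
      (⟨i, G, rfl, hG, hgG⟩ | ⟨c', ρ', rfl, hg⟩) hx₁ hx₂
    -- Different `V j` are disjoint, so two sections over filled holes can overlap only over the
    -- same hole, and there they are compared on the connected annular domain.
    · obtain rfl : j = i := by
        by_contra hne
        exact hWV.disjoint_outer hne hx₁ hx₂
      filter_upwards [(hWV.nhd_outer.isOpen j).mem_nhds hx₁] with y hy
      rw [hfF, hgG, hfF, hgG]
      exact hF.eq_iff hG (hWV.isPathConnected_diff j) (hWV.push_mem_diff hy)
        (hWV.push_mem_diff hx₁)
    · exact hmixed (hWV.isOpen_diff j) Metric.isOpen_ball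
        ⟨hx₁, IsNestedPair.coe_mem_perforated_iff.1 (hg.subset x hx₂) j⟩ hx₂ hF hg (hpush hfF)
        fun _ _ => rfl
    · exact hmixed Metric.isOpen_ball (hWV.isOpen_diff i) hx₁
        ⟨hx₂, IsNestedPair.coe_mem_perforated_iff.1 (hf.subset x hx₁) i⟩ hf hG (fun _ _ => rfl)
        (hpush hgG)
    · exact hmixed Metric.isOpen_ball Metric.isOpen_ball hx₁ hx₂ hf hg (fun _ _ => rfl)
        fun _ _ => rfl
  val := by
    rintro U f y (⟨j, F, rfl, hF, hfF⟩ | ⟨c, ρ, rfl, hf⟩) hy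
    · rw [hfF]
      exact hF.1 _ (hWV.push_mem_diff hy)
    · rw [hWV.push_of_mem (hf.subset y hy)]
      exact hf.1 y hy

theorem exists_isCovBranch_near (hWV : IsNestedPair D t₀ W V) (hT : Transports r)
    (hloop : ∀ (j : Fin n) (p : (V j \ closure (W j) : Set ℂ))
      (α : Path.Homotopic.Quotient (perforatedInfty W) (coeMap (hWV.coe_mem_perforated j) p))
      (δ : Path p p), r (Cov.mk _ (α.trans ((Path.Homotopic.Quotient.mk δ).map
        (coeMap (hWV.coe_mem_perforated j))))) = r (Cov.mk _ α)) {f : ℂ → A}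
    (hf : (perforatedBranches hWV hT hloop).IsBranchOn Set.univ f) {z : ℂ}
    (hz : (z : CP1) ∈ perforatedSphere W) : ∃ ρ > 0, IsCovBranch r (Metric.ball z ρ) f := by
  obtain ⟨U, g, hg, hzU, he⟩ := hf z (Set.mem_univ z)
  rw [nhdsWithin_univ] at he
  obtain ⟨ρ, hρ, hball⟩ := Metric.mem_nhds_iff.1 (Filter.inter_mem he
    (Filter.inter_mem ((isOpen_setOf_coe_mem_perforated W).mem_nhds hz)
      (((perforatedBranches hWV hT hloop).isOpen hg).mem_nhds hzU)))
  refine ⟨ρ, hρ, ?_⟩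
  rcases hg with ⟨j, F, rfl, hF, hgF⟩ | ⟨c, ρ', rfl, hg⟩
  · refine (hF.mono fun w hw => ⟨(hball hw).2.2,
      IsNestedPair.coe_mem_perforated_iff.1 (hball hw).2.1 j⟩).congr fun w hw => ?_
    have h1 : f w = g w := (hball hw).1
    rw [h1, hgF, hWV.push_of_mem (hball hw).2.1]
  · exact (hg.mono fun w hw => (hball hw).2.2).congr fun w hw => (hball hw).1.symm

/-- A multivalued function on the perforated sphere that is single-valued near `∞` and in each of
the annular domains `Vⱼ ∖ closure Wⱼ` is single-valued. -/
theorem eq_of_loops (hWV : IsNestedPair D t₀ W V) (hT : Transports r)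
    (hloop : ∀ (j : Fin n) (p : (V j \ closure (W j) : Set ℂ))
      (α : Path.Homotopic.Quotient (perforatedInfty W) (coeMap (hWV.coe_mem_perforated j) p))
      (δ : Path p p), r (Cov.mk _ (α.trans ((Path.Homotopic.Quotient.mk δ).map
        (coeMap (hWV.coe_mem_perforated j))))) = r (Cov.mk _ α))
    {N : Set (perforatedSphere W)} (hN : N ∈ 𝓝 (perforatedInfty W)) {φ : perforatedSphere W → A}
    (hφ : ∀ (y : perforatedSphere W) (β : Path (perforatedInfty W) y), (∀ s, β s ∈ N) →
      r (Cov.mk y (Path.Homotopic.Quotient.mk β)) = φ y)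
    (γ : Path.Homotopic.Quotient (perforatedInfty W) (perforatedInfty W)) :
    r (Cov.mk _ γ) = r (Cov.mk _ (Path.Homotopic.Quotient.refl _)) := by
  classical
  obtain ⟨R₁, hR₁, hRN⟩ := exists_radius_of_mem_nhds_infty (perforatedInfty W).2 hN
  obtain ⟨R₂, hR₂⟩ := hWV.exists_radius
  -- Beyond `R₁` the single-valuedness near `∞` applies, beyond `R₂` there are no holes; the `1`
  -- makes `R` positive, so that the exterior is connected as an image under `exp`.
  set R := max (max R₁ R₂) 1 with hRdef
  have hR0 : 0 < R := lt_of_lt_of_le one_pos (le_max_right _ _)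
  have hRS : ∀ z : ℂ, R < ‖z‖ → (z : CP1) ∈ perforatedSphere W := fun z hz =>
    hR₂ z (((le_max_right _ _).trans (le_max_left _ _)).trans_lt hz)
  have hRN' : ∀ x : perforatedSphere W, ((x : CP1) = ∞ ∨ ∃ z : ℂ, R < ‖z‖ ∧ (x : CP1) = z) →
      x ∈ N := fun x hx => hRN x (hx.imp_right fun ⟨z, hz, h⟩ =>
        ⟨z, ((le_max_left _ _).trans (le_max_left _ _)).trans_lt hz, h⟩)
  set U : Set ℂ := {z | R < ‖z‖} with hU
  set f₀ : ℂ → A := fun z => if hz : (z : CP1) ∈ perforatedSphere W then φ ⟨z, hz⟩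
    else φ (perforatedInfty W) with hf₀
  have hf₀U : ∀ (z : ℂ) (hz : z ∈ U), f₀ z = φ ⟨z, hRS z hz⟩ := fun z hz => dif_pos (hRS z hz)
  have hf₀b : IsCovBranch r U f₀ := by
    have hex : ∀ (z : ℂ) (hz : z ∈ U), ∃ β : Path (perforatedInfty W) ⟨z, hRS z hz⟩,
        ∀ s, (β s : CP1) = ∞ ∨ ∃ w : ℂ, R < ‖w‖ ∧ (β s : CP1) = w := fun z hz =>
      exists_path_infty (perforatedInfty W).2 hR0.le hRS hz
    refine ⟨fun z hz => ?_, ?_⟩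
    · obtain ⟨β, hβ⟩ := hex z hz
      refine ⟨Cov.mk _ (Path.Homotopic.Quotient.mk β), rfl, ?_⟩
      rw [hf₀U z hz]
      exact hφ _ β fun s => hRN' _ (hβ s)
    · rintro ⟨⟨x, hx⟩, α⟩ ⟨y, hy⟩ β hβ hr
      obtain ⟨z, hz, hzx⟩ := hβ 0
      obtain ⟨w, hw, hwy⟩ := hβ 1
      rw [β.source] at hzx
      rw [β.target] at hwy
      change x = z at hzx
      change y = w at hwy
      subst hzx hwy
      change r ⟨_, α⟩ = f₀ z at hr
      change r (Cov.mk _ (α.trans (Path.Homotopic.Quotient.mk β))) = f₀ w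
      obtain ⟨β₀, hβ₀⟩ := hex z hz
      have h1 : r (Cov.mk _ (Path.Homotopic.Quotient.mk β₀)) = f₀ z := by
        rw [hf₀U z hz]
        exact hφ _ β₀ fun s => hRN' _ (hβ₀ s)
      rw [(hT _ _ α (Path.Homotopic.Quotient.mk β₀) (Path.Homotopic.Quotient.mk β)).2
        (hr.trans h1.symm), ← Path.Homotopic.Quotient.mk_trans, hf₀U w hw]
      refine hφ _ _ fun s => ?_
      have hs : (β₀.trans β) s ∈ Set.range (β₀.trans β) := ⟨s, rfl⟩
      rw [Path.trans_range] at hs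
      rcases hs with ⟨u, hu⟩ | ⟨u, hu⟩
      · rw [← hu]
        exact hRN' _ (hβ₀ u)
      · rw [← hu]
        exact hRN' _ (Or.inr (hβ u))
  have hx₀ : ((R + 1 : ℝ) : ℂ) ∈ U := by
    change R < ‖((R + 1 : ℝ) : ℂ)‖
    rw [Complex.norm_real, Real.norm_of_nonneg (by linarith)]
    linarith
  -- The global branch is started from a value of the single-valued branch `f₀` near `∞`; they then
  -- agree on the whole exterior `U`.
  obtain ⟨f, hf, hfx₀⟩ := (perforatedBranches hWV hT hloop).exists_global ((R + 1 : ℝ) : ℂ)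
    (f₀ ((R + 1 : ℝ) : ℂ)) (by
      obtain ⟨P, hP, hr⟩ := hf₀b.1 _ hx₀
      exact ⟨P, by rw [hP, hWV.push_of_mem (hRS _ hx₀)], hr⟩)
  have hfnear : ∀ z : ℂ, (z : CP1) ∈ perforatedSphere W →
      ∃ ρ > 0, IsCovBranch r (Metric.ball z ρ) f := fun z hz =>
    exists_isCovBranch_near hWV hT hloop hf hz
  have hff₀ : ∀ z ∈ U, f z = f₀ z := by
    intro z hz
    refine ((isPreconnected_lt_norm hR0).induction₂ (fun a b => f a = f₀ a ↔ f b = f₀ b) ?_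
      (fun a b c _ _ _ h1 h2 => h1.trans h2) (fun a b _ _ h => h.symm) hx₀ hz).1 hfx₀
    intro a ha
    obtain ⟨ρ, hρ, hfb⟩ := hfnear a (hRS a ha)
    obtain ⟨ρ', hρ', hball⟩ := Metric.isOpen_iff.1
      ((isOpen_lt continuous_const continuous_norm : IsOpen U).inter Metric.isOpen_ball) a
      ⟨ha, Metric.mem_ball_self hρ⟩
    refine nhdsWithin_le_nhds ?_
    filter_upwards [Metric.ball_mem_nhds a hρ'] with b hb
    exact (hfb.mono fun w hw => (hball hw).2).eq_iff (hf₀b.mono fun w hw => (hball hw).1)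
      ((convex_ball a ρ').isPathConnected ⟨a, Metric.mem_ball_self hρ'⟩)
      (Metric.mem_ball_self hρ') hb
  -- The candidate single-valued function. The relation `r P = F P.1` is locally constant along
  -- paths and holds over the distinguished point, hence holds at `(∞, γ)`.
  set F : CP1 → A := fun x => if x = ∞ then r (Cov.mk _ (Path.Homotopic.Quotient.refl _))
    else f (affineCoord x) with hF
  have hFinf : F ∞ = r (Cov.mk _ (Path.Homotopic.Quotient.refl _)) := if_pos rfl
  have hFcoe : ∀ z : ℂ, F z = f z := fun z => if_neg (OnePoint.coe_ne_infty z)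
  have key := Cov.iff_of_locally_iff
    (p := fun P : Cov (perforatedInfty W) => r P = F P.1) ?_ (Cov.mk _ γ)
  · have h1 := key.2 hFinf.symm
    exact h1.trans hFinf
  rintro ⟨⟨x, hx⟩, α⟩
  induction x using OnePoint.rec with
  | infty =>
    set N' : Set (perforatedSphere W) := {x | (x : CP1) = ∞ ∨ ∃ z : ℂ, R < ‖z‖ ∧ (x : CP1) = z}
      with hN'
    have hN'mem : N' ∈ 𝓝 (⟨∞, hx⟩ : perforatedSphere W) := by
      have h1 : {x : CP1 | x = ∞ ∨ ∃ z : ℂ, R < ‖z‖ ∧ x = z} ∈ 𝓝 (∞ : CP1) := by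
        refine OnePoint.hasBasis_nhds_infty.mem_iff.2 ⟨Metric.closedBall 0 R,
          ⟨Metric.isClosed_closedBall, isCompact_closedBall 0 R⟩, ?_⟩
        rintro x (⟨z, hz, rfl⟩ | rfl)
        · refine Or.inr ⟨z, ?_, rfl⟩
          rwa [Set.mem_compl_iff, mem_closedBall_zero_iff, not_le] at hz
        · exact Or.inl rfl
      exact continuous_subtype_val.continuousAt (x := (⟨∞, hx⟩ : perforatedSphere W)) h1
    refine ⟨N', hN'mem, fun y β hβ => ?_⟩
    have h1 := hφ y β fun s => hRN' _ (hβ s)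
    have h2 : φ y = F y := by
      have hy := hβ 1
      rw [β.target] at hy
      obtain ⟨y, hyS⟩ := y
      rcases hy with hy | ⟨z, hz, hy⟩
      · change y = ∞ at hy
        subst hy
        have h3 := hφ ⟨∞, hyS⟩ (Path.refl _) fun s => hRN' _ (Or.inl rfl)
        exact h3.symm.trans hFinf.symm
      · change y = z at hy
        subst hy
        change _ = F z
        rw [hFcoe, hff₀ z hz, hf₀U z hz]
    -- Near `∞` the branch along `α` is compared with the trivial one, whose continuation is given
    -- by `F`.
    have h4 := hT _ _ α (Path.Homotopic.Quotient.refl _) (Path.Homotopic.Quotient.mk β)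
    have h6 : r (Cov.mk y ((Path.Homotopic.Quotient.refl (perforatedInfty W)).trans
        (Path.Homotopic.Quotient.mk β))) = r (Cov.mk y (Path.Homotopic.Quotient.mk β)) :=
      congrArg (fun q => r (Cov.mk y q)) (Path.Homotopic.Quotient.refl_trans _)
    have h5 := h1.trans h2
    change r (Cov.mk y (α.trans (Path.Homotopic.Quotient.mk β))) = F y ↔ r (Cov.mk _ α) = F ∞
    rw [← h5, hFinf, ← h6]
    exact h4
  | coe z =>
    obtain ⟨ρ, hρ, hfb⟩ := hfnear z hx
    refine ⟨{x | ∃ w ∈ Metric.ball z ρ, (x : CP1) = w}, ?_, fun y β hβ => ?_⟩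
    · have h1 : ((↑) : ℂ → CP1) '' Metric.ball z ρ ∈ 𝓝 (z : CP1) :=
        OnePoint.isOpenEmbedding_coe.image_mem_nhds.2 (Metric.ball_mem_nhds z hρ)
      have h2 := continuous_subtype_val.continuousAt (x := (⟨(z : CP1), hx⟩ : perforatedSphere W)) h1
      filter_upwards [h2] with x hx
      obtain ⟨w, hw, hwx⟩ := hx
      exact ⟨w, hw, hwx.symm⟩
    · obtain ⟨w, hw, hwy⟩ := hβ 1
      rw [β.target] at hwy
      obtain ⟨y, hyS⟩ := y
      change y = w at hwy
      subst hwy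
      change r (Cov.mk _ (α.trans (Path.Homotopic.Quotient.mk β))) = F w ↔ r (Cov.mk _ α) = F z
      rw [hFcoe, hFcoe]
      -- For the converse direction, a point over `z` realizing the branch value is continued along
      -- the same `β`, and `Transports` brings the equality back.
      refine ⟨fun h => ?_, fun h => hfb.2 ⟨_, α⟩ _ β hβ h⟩
      obtain ⟨⟨⟨x', hx'⟩, α'⟩, hP, hr⟩ := hfb.1 z (Metric.mem_ball_self hρ)
      change x' = z at hP
      subst hP
      have h1 := hfb.2 ⟨_, α'⟩ _ β hβ hr
      exact ((hT _ _ α α' _).1 (h.trans h1.symm)).trans hr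

end Global

/-- The normalized solution is single-valued near `∞`. -/
theorem exists_nhd_perforatedSolution {n k : ℕ}
    {Y : ∀ t : Fin n → ℂ, Cov (puncturedInfty t) → Matrix (Fin k) (Fin k) ℂ}
    {W : Fin n → Set ℂ} {t : Fin n → ℂ} (ht : t ∈ cylinder W)
    {Q : Fin n → Matrix (Fin k) (Fin k) ℂ} (hY : IsNormalizedSolution t Q (Y t)) :
    ∃ N ∈ 𝓝 (perforatedInfty W), ∃ φ : perforatedSphere W → Matrix (Fin k) (Fin k) ℂ,
      ∀ (y : perforatedSphere W) (β : Path (perforatedInfty W) y), (∀ s, β s ∈ N) →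
        perforatedSolution Y ht (Cov.mk y (Path.Homotopic.Quotient.mk β)) = φ y := by
  obtain ⟨g, ⟨N, hN, hg⟩, -⟩ := hY.holomorphic_infty
    (Cov.mk (puncturedInfty t) (Path.Homotopic.Quotient.refl _)) rfl
  refine ⟨perforatedInclusion ht ⁻¹' N, (perforatedInclusion ht).continuous.continuousAt hN,
    fun y => g (inftyCoord (y : CP1)), fun y β hβ => ?_⟩
  have h1 := hg _ (β.map (perforatedInclusion ht).continuous) hβ
  refine Eq.trans (congrArg (fun q => Y t (Cov.mk _ q)) ?_) h1
  exact (Path.Homotopic.Quotient.refl_trans _).symm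

end Fuchsian

/-! ### Conclusion -/

/-- Every isoprincipal holomorphic family of Fuchsian systems is isomonodromic (both with the
distinguished point `∞`). -/
theorem theorem2p1 (n k : ℕ) (D : Set (Fin n → ℂ))
    (Q : (Fin n → ℂ) → Fin n → Matrix (Fin k) (Fin k) ℂ)
    (hQ : Fuchsian.IsHolomorphicFamily D Q)
    (hsum : ∀ t ∈ D, ∑ j, Q t j = 0)
    (hiso : Fuchsian.IsIsoprincipal D Q) :
    Fuchsian.IsIsomonodromic D Q := by
  open Fuchsian in
  obtain ⟨Y, hY, h⟩ := hiso
  refine ⟨Y, hY, fun t₀ ht₀ => ?_⟩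
  obtain ⟨W, V, hWV, hE⟩ := h t₀ ht₀
  have hEV : IsoprincipalOn Y hWV := hE
  have hWD : ∀ t ∈ cylinder W, t ∈ D := fun t ht => (hWV.inner.subset (subset_closure ht)).2
  refine ⟨W, hWV.nhd_inner, ⟨hQ.isOpen, hWV.inner.isCompact,
    hWV.inner.subset.trans Set.inter_subset_right⟩, fun γ t' t'' ht' ht'' => ?_⟩
  have hm : ∀ (t : Fin n → ℂ) (ht : t ∈ cylinder W), HasMonodromy (perforatedSolution Y ht) :=
    fun t ht => hasMonodromy_perforatedSolution ht (hsum t (hWD t ht)) (hY t (hWD t ht))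
  set r : Cov (perforatedInfty W) → Matrix (Fin k) (Fin k) ℂ := fun P =>
    perforatedSolution Y ht' P * (perforatedSolution Y ht'' P)⁻¹ with hr
  have hT : Transports r := fun x y α α' β => (hm t' ht').ratio_eq_iff (hm t'' ht'') α α' β
  obtain ⟨N, hN, φ, hφ⟩ := exists_nhd_perforatedSolution (W := W) ht' (hY t' (hWD t' ht'))
  obtain ⟨N', hN', ψ, hψ⟩ := exists_nhd_perforatedSolution (W := W) ht'' (hY t'' (hWD t'' ht''))
  have hone : ∀ (t : Fin n → ℂ) (ht : t ∈ cylinder W),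
      perforatedSolution Y ht (Cov.mk _ (Path.Homotopic.Quotient.refl _)) = 1 :=
    fun t ht => (hY t (hWD t ht)).normalized
  -- A loop in an annular domain multiplies both solutions from the right by the same invertible
  -- local monodromy matrix, which cancels in the ratio `r`.
  have key := eq_of_loops hWV hT (fun j p α δ => by
      obtain ⟨p, hp⟩ := p
      induction α using Path.Homotopic.Quotient.ind with | mk α =>
      have h1 := hEV.localMonodromy_eq hm α δ ht' ht''
      have h2 : ∀ (t : Fin n → ℂ) (ht : t ∈ cylinder W),
          perforatedSolution Y ht (Cov.mk _ ((Path.Homotopic.Quotient.mk α).trans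
            ((Path.Homotopic.Quotient.mk δ).map (coeMap (hWV.coe_mem_perforated j))))) =
          perforatedSolution Y ht (Cov.mk _ (Path.Homotopic.Quotient.mk α)) *
            localMonodromy Y hWV α δ ht := fun t ht =>
        (Matrix.mul_nonsing_inv_cancel_left _ _ ((hm t ht).isUnit_det _)).symm
      have h3 : IsUnit (localMonodromy Y hWV α δ ht'').det := by
        have h6 := Matrix.det_mul (perforatedSolution Y ht''
          (Cov.mk _ (Path.Homotopic.Quotient.mk α)))⁻¹ (perforatedSolution Y ht''
          (Cov.mk _ ((Path.Homotopic.Quotient.mk α).trans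
            ((Path.Homotopic.Quotient.mk δ).map (coeMap (hWV.coe_mem_perforated j))))))
        refine (congrArg IsUnit h6).mpr ?_
        exact ((Matrix.isUnit_nonsing_inv_det_iff).2 ((hm t'' ht'').isUnit_det _)).mul
          ((hm t'' ht'').isUnit_det _)
      have h4 : ∀ A B M : Matrix (Fin k) (Fin k) ℂ, IsUnit M.det →
          A * M * (B * M)⁻¹ = A * B⁻¹ := by
        intro A B M hM
        rw [Matrix.mul_inv_rev, mul_assoc, Matrix.mul_nonsing_inv_cancel_left _ _ hM]
      have h5 := h4 (perforatedSolution Y ht' (Cov.mk _ (Path.Homotopic.Quotient.mk α)))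
        (perforatedSolution Y ht'' (Cov.mk _ (Path.Homotopic.Quotient.mk α))) _ h3
      refine Eq.trans ?_ h5
      refine congrArg₂ (fun A B => A * B⁻¹) ((h2 t' ht').trans ?_) (h2 t'' ht'')
      rw [h1]) (Filter.inter_mem hN hN')
    (φ := fun y => φ y * (ψ y)⁻¹) (fun y β hβ => by
      rw [hr]
      dsimp only
      rw [hφ y β fun s => (hβ s).1, hψ y β fun s => (hβ s).2])
    (Path.Homotopic.Quotient.mk γ)
  rw [hr] at key
  dsimp only at key
  rw [hone, hone, inv_one, mul_one] at key
  -- Now `r = 1` at `(∞, γ)`, so the two solutions, and with them the two monodromy matrices,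
  -- coincide there.
  have heq : perforatedSolution Y ht' (Cov.mk _ (Path.Homotopic.Quotient.mk γ)) =
      perforatedSolution Y ht'' (Cov.mk _ (Path.Homotopic.Quotient.mk γ)) := by
    have h1 := congrArg (· * perforatedSolution Y ht'' (Cov.mk _ (Path.Homotopic.Quotient.mk γ))) key
    rwa [Matrix.nonsing_inv_mul_cancel_right _ _ ((hm t'' ht'').isUnit_det _), one_mul] at h1
  refine ⟨Y t' (Cov.mk _ (Path.Homotopic.Quotient.mk (toPunctured ht' γ))),
    (hY t' (hWD t' ht')).isMonodromyMatrix (hsum t' (hWD t' ht')) _, ?_⟩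
  have h1 := (hY t'' (hWD t'' ht'')).isMonodromyMatrix (hsum t'' (hWD t'' ht''))
    (Path.Homotopic.Quotient.mk (toPunctured ht'' γ))
  have h2 : Y t' (Cov.mk _ (Path.Homotopic.Quotient.mk (toPunctured ht' γ))) =
      Y t'' (Cov.mk _ (Path.Homotopic.Quotient.mk (toPunctured ht'' γ))) := heq
  rw [h2]
  exact h1
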